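/- **Setting.** Finite relational structures are given by listing their universe and relations. For structures $\mathcal A,\mathcal B$ over the same vocabulary and a set $O$ of elements ("variables") of $\mathcal A$, $\mathcal A^{\mathcal B}[O]$ is the set of restrictions to $O$ of the homomorphisms $\mathcal A\to\mathcal B$ (for $O=\emptyset$ it contains the empty map if there is a homomorphism, and is empty otherwise). $\mathcal H_{\mathcal A}$ is the hypergraph whose nodes are the elements of $\mathcal A$, with one hyperedge consisting of the variables of $t$ for each tuple $t$ of each relation of $\mathcal A$. A tree projection of a hypergraph $\mathcal H_1$ with respect to $\mathcal H_2$ is a hypergraph $\mathcal H_a$ that has a join tree and such that every hyperedge of $\mathcal H_1$ is contained in one of $\mathcal H_a$ and every hyperedge of $\mathcal H_a$ in one of $\mathcal H_2$. A *view structure* for $\mathcal A$ is a structure $\mathcal A_{\mathcal V}$ on the same universe, over a disjoint vocabulary, in which every relation ("view") consists of a single tuple, and which contains for every tuple $t$ of a relation $R^{\mathcal A}$ a *base view* $R_t$ with $R_t^{\mathcal A_{\mathcal V}}=\{t\}$. A structure $\mathcal B_{\mathcal V}$ over the vocabulary of $\mathcal A_{\mathcal V}$ is *legal* if $\mathcal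 A^{\mathcal B}[w]\subseteq R^{\mathcal B_{\mathcal V}}$ for every view $R$ with variables $w$, and $R_t^{\mathcal B_{\mathcal V}}\subseteq R^{\mathcal B}$ for every base view. A *decomposition method* $\mathtt{DM}$ is a pair of polynomial-time computable functions $\ell\text{-}\mathtt{DM}$, $r\text{-}\mathtt{DM}$ such that, for all $(\mathcal A,\mathcal B)$, $\ell\text{-}\mathtt{DM}(\mathcal A)$ is a view structure for $\mathcal A$ and $r\text{-}\mathtt{DM}(\mathcal A,\mathcal B)$ is legal with respect to it and $(\mathcal A,\mathcal B)$. $\mathtt{GAC}(\mathcal A_{\mathcal V},\mathcal B_{\mathcal V})$ results from $\mathcal B_{\mathcal V}$ by deleting tuples until any two views with common variables allow the same values on these. **Algorithm $\mathtt{ComputeCertifiedSolutions}_{\mathtt{DM}}$.** Input: $(\mathcal A,\mathcal B,O)$ with $O=\{X_1,\dots,X_m\}$; let $X_1,\dots,X_n$ be all the variables of $\mathcal A$. 1. If for some variable $X$ there is no unary relation symbol interpreted in $\mathcal A$ by $\{X\}$, add for every variable $X$ a fresh unary symbol $\mathit{dom}(X)$, interpreted by $\{X\}$ in $\mathcal A$,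 and in $\mathcal B$ by the values that some constraint relation, freely chosen among those of the constraints in which $X$ occurs, has at a position of $X$ (by the whole universe of $\mathcal B$ if $X$ occurs in no constraint). Let $(\mathcal A^*,\mathcal B^*)$ be the result; it has a symbol $\mathit{dom}(X)$ for every variable. 2. Let $\mathcal A_{\mathcal V}=\ell\text{-}\mathtt{DM}(\mathcal A^*)$ and $\mathcal B_{\mathcal V}=r\text{-}\mathtt{DM}(\mathcal A^*,\mathcal B^*)$, and call $\mathrm{CPropagate}(1,\mathcal B_{\mathcal V},\langle\rangle)$. $\mathrm{CPropagate}(i,\mathcal B_{\mathcal V},\langle a_1,\dots,a_{i-1}\rangle)$: let $\mathcal B'_{\mathcal V}=\mathtt{GAC}(\mathcal A_{\mathcal V},\mathcal B_{\mathcal V})$. If $i>1$ and a relation of $\mathcal B'_{\mathcal V}$ is empty, output "$\mathtt{DM}$ failure" and halt the whole computation. Otherwise, for each value $a_i$ in the base view of $\mathit{dom}(X_i)$ in $\mathcal B'_{\mathcal V}$: if $i=n$, output $(\langle a_1,\dots,a_m\rangle,\langle a_{m+1},\dots,a_n\rangle)$; if $i<n$, call $\mathrm{CPropagate}(i+1,\mathcal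 B''_{\mathcal V},\langle a_1,\dots,a_i\rangle)$, where $\mathcal B''_{\mathcal V}$ is $\mathcal B'_{\mathcal V}$ with the base view of $\mathit{dom}(X_i)$ replaced by $\{a_i\}$. If $i>m$, leave this loop after its first value. **Theorem.** For every decomposition method $\mathtt{DM}$ there is a polynomial $p$ such that the following holds for every connected structure $\mathcal A$ (that is, $\mathcal H_{\mathcal A}$ is non-empty and connected and has no empty hyperedge), every set $O$ of variables of $\mathcal A$, every structure $\mathcal B$ over the vocabulary of $\mathcal A$, and all free choices in step 1. On input $(\mathcal A,\mathcal B,O)$ of size $s$, at most $p(s)$ elementary steps (a call of $\ell\text{-}\mathtt{DM}$ or $r\text{-}\mathtt{DM}$ counting with the steps of its Turing machine and the lengths of its input and output) pass before the first output of $\mathtt{ComputeCertifiedSolutions}_{\mathtt{DM}}$, between consecutive outputs, and from the last output to termination. Each output other than "$\mathtt{DM}$ failure" is a pair $(h,c)$ with $h\in\mathcal A^{\mathcal B}[O]$ such that $h$ and $c$ together form a homomorphism $\mathcal A\to\mathcal B$; no $h$ is output twice. Moreover: - If the algorithm outputs "$\mathtt{DM}$ failure", then $\mathcal H_{\mathcal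 A}$ has no tree projection with respect to the view hypergraph $\mathcal H_{\ell\text{-}\mathtt{DM}(\mathcal A^*)}$; hence it has none with respect to $\mathcal H_{\ell\text{-}\mathtt{DM}(\mathcal A)}$ either, provided that every hyperedge of $\mathcal H_{\ell\text{-}\mathtt{DM}(\mathcal A)}$ is contained in one of $\mathcal H_{\ell\text{-}\mathtt{DM}(\mathcal A^*)}$. - Otherwise, the set of all $h$ that are output is exactly $\mathcal A^{\mathcal B}[O]$ (with polynomial delay, as above). -/

import Mathlib

namespace CertEnum

/-! ## Finite relational structures

A finite structure is given by a listing: its universe is `{0, …, card - 1}`, its relation symbols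
are the positions in the list `rels`, and each relation is a duplicate-free list of tuples. -/

structure RelTable where
  arity : ℕ
  tuples : List (List ℕ)

structure RelStructure where
  card : ℕ
  rels : List RelTable
  wf : ∀ r ∈ rels, r.tuples.Nodup ∧ ∀ t ∈ r.tuples, t.length = r.arity ∧ ∀ x ∈ t, x < card

/-- The vocabulary: the list of the arities of the relation symbols. -/
def RelStructure.vocabulary (A : RelStructure) : List ℕ := A.rels.map RelTable.arity

/-- A CSP instance `(A, B)`: two structures over the same vocabulary. -/
structure CSPInstance where
  lhs : RelStructure
  rhs : RelStructure
  same_vocabulary : lhs.vocabulary = rhs.vocabulary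

/-- An ECSP instance `(A, B, O)`; the output variables are listed as `X₁, …, X_m`. -/
structure ECSPInstance extends CSPInstance where
  out : List ℕ
  out_nodup : out.Nodup
  out_lt : ∀ x ∈ out, x < lhs.card

/-- `g` is a homomorphism from `A` to `B` (only its values on the universe of `A` matter). -/
def IsHom (A B : RelStructure) (g : ℕ → ℕ) : Prop :=
  (∀ x < A.card, g x < B.card) ∧
    ∀ p ∈ A.rels.zip B.rels, ∀ t ∈ p.1.tuples, t.map g ∈ p.2.tuples

/-- `A^B[w]`: the restrictions of the homomorphisms to the variables listed in `w`, each one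
written as the list of its values along `w`. For `w = []` this is `{[]}` or `∅` according to
whether or not there is a homomorphism. -/
def CSPInstance.solutions (I : CSPInstance) (w : List ℕ) : Set (List ℕ) :=
  {h | ∃ g, IsHom I.lhs I.rhs g ∧ w.map g = h}

/-! ## Encodings as bit strings

Numbers are written in unary: a structure lists its universe, so its size is at least `card`, and
this changes sizes at most polynomially. -/

def encNat (n : ℕ) : List Bool := List.replicate n true ++ [false]

def encList {α : Type} (enc : α → List Bool) (l : List α) : List Bool :=
  encNat l.length ++ l.flatMap enc

def encTuple (t : List ℕ) : List Bool := encList encNat t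

def RelTable.encode (r : RelTable) : List Bool := encNat r.arity ++ encList encTuple r.tuples

def RelStructure.encode (A : RelStructure) : List Bool :=
  encNat A.card ++ encList RelTable.encode A.rels

def CSPInstance.encode (I : CSPInstance) : List Bool := I.lhs.encode ++ I.rhs.encode

def ECSPInstance.encode (I : ECSPInstance) : List Bool :=
  I.toCSPInstance.encode ++ encTuple I.out

/-- The size of an ECSP instance. -/
def ECSPInstance.size (I : ECSPInstance) : ℕ := I.encode.length

def PrefixCode {α : Type} (enc : α → List Bool) : Prop :=
  ∀ x y s t, enc x ++ s = enc y ++ t → x = y ∧ s = t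

theorem PrefixCode.injective {α : Type} {enc : α → List Bool} (h : PrefixCode enc) :
    Function.Injective enc :=
  fun x y hxy => (h x y [] [] (by rw [hxy])).1

theorem prefixCode_encNat : PrefixCode encNat := by
  intro x
  induction x with
  | zero =>
    intro y s t h
    cases y with
    | zero => simpa [encNat] using h
    | succ y => simp [encNat, List.replicate_succ] at h
  | succ x ih =>
    intro y s t h
    cases y with
    | zero => simp [encNat, List.replicate_succ] at h
    | succ y =>
      have := ih y s t (by simpa [encNat, List.replicate_succ] using h)
      exact ⟨by rw [this.1], this.2⟩

theorem PrefixCode.list {α : Type} {enc : α → List Bool} (h : PrefixCode enc) :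
    PrefixCode (encList enc) := by
  have aux : ∀ (l l' : List α) (s t : List Bool), l.length = l'.length →
      l.flatMap enc ++ s = l'.flatMap enc ++ t → l = l' ∧ s = t := by
    intro l
    induction l with
    | nil =>
      intro l' s t hl h'
      cases l' with
      | nil => simpa using h'
      | cons b l' => simp at hl
    | cons a l ih =>
      intro l' s t hl h'
      cases l' with
      | nil => simp at hl
      | cons b l' =>
        simp only [List.flatMap_cons, List.append_assoc] at h'
        obtain ⟨rfl, h''⟩ := h _ _ _ _ h'
        obtain ⟨rfl, h3⟩ := ih l' s t (by simpa using hl) h''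
        exact ⟨rfl, h3⟩
  intro l l' s t h'
  simp only [encList, List.append_assoc] at h'
  obtain ⟨h1, h2⟩ := prefixCode_encNat _ _ _ _ h'
  exact aux l l' s t h1 h2

theorem prefixCode_relTable : PrefixCode RelTable.encode := by
  rintro ⟨a, l⟩ ⟨a', l'⟩ s t h
  simp only [RelTable.encode, List.append_assoc] at h
  obtain ⟨rfl, h2⟩ := prefixCode_encNat _ _ _ _ h
  obtain ⟨rfl, h3⟩ := prefixCode_encNat.list.list _ _ _ _ h2
  exact ⟨rfl, h3⟩

theorem prefixCode_relStructure : PrefixCode RelStructure.encode := by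
  rintro ⟨a, l, w⟩ ⟨a', l', w'⟩ s t h
  simp only [RelStructure.encode, List.append_assoc] at h
  obtain ⟨rfl, h2⟩ := prefixCode_encNat _ _ _ _ h
  obtain ⟨rfl, h3⟩ := prefixCode_relTable.list _ _ _ _ h2
  exact ⟨rfl, h3⟩

theorem prefixCode_cspInstance : PrefixCode CSPInstance.encode := by
  rintro ⟨A, B, w⟩ ⟨A', B', w'⟩ s t h
  simp only [CSPInstance.encode, List.append_assoc] at h
  obtain ⟨rfl, h2⟩ := prefixCode_relStructure _ _ _ _ h
  obtain ⟨rfl, h3⟩ := prefixCode_relStructure _ _ _ _ h2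
  exact ⟨rfl, h3⟩

theorem prefixCode_ecspInstance : PrefixCode ECSPInstance.encode := by
  rintro ⟨I, O, w₁, w₂⟩ ⟨I', O', w₁', w₂'⟩ s t h
  simp only [ECSPInstance.encode, List.append_assoc] at h
  obtain ⟨rfl, h2⟩ := prefixCode_cspInstance _ _ _ _ h
  obtain ⟨rfl, h3⟩ := prefixCode_encNat.list _ _ _ _ h2
  exact ⟨rfl, h3⟩

/-! ## Hypergraphs and tree projections -/

/-- The hypergraph of a structure: one hyperedge for the variables of each tuple. -/
def RelStructure.hypergraph (A : RelStructure) : Hypergraph ℕ where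
  vertexSet := {x | x < A.card}
  edgeSet := {e | ∃ r ∈ A.rels, ∃ t ∈ r.tuples, e = {x | x ∈ t}}
  subset_vertexSet_of_mem_edgeSet' := by
    rintro e ⟨r, hr, t, ht, rfl⟩ x hx
    exact ((A.wf r hr).2 t ht).2 x hx

/-- Connectedness: there is a node, and any two nodes are linked by hyperedges. An empty hyperedge
would form a component of its own and is excluded. -/
def IsConnected (H : Hypergraph ℕ) : Prop :=
  H.vertexSet.Nonempty ∧ (∀ e ∈ H.edgeSet, e.Nonempty) ∧
    ∀ x ∈ H.vertexSet, ∀ y ∈ H.vertexSet, Relation.ReflTransGen H.Adj x y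

/-- A join tree: a tree on the hyperedges (no vertex at all if there are no hyperedges) such that
a node that lies in two hyperedges lies in every hyperedge on the path between them. -/
def IsJoinTree (H : Hypergraph ℕ) (T : SimpleGraph H.edgeSet) : Prop :=
  T.Preconnected ∧ T.IsAcyclic ∧
    ∀ (x : ℕ) (e f : H.edgeSet), x ∈ e.1 → x ∈ f.1 →
      ∀ q : T.Walk e f, q.IsPath → ∀ k ∈ q.support, x ∈ k.1

def IsAcyclic (H : Hypergraph ℕ) : Prop := ∃ T : SimpleGraph H.edgeSet, IsJoinTree H T

/-- Each hyperedge of `H₁` is contained in a hyperedge of `H₂`. -/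
def CoveredBy (H₁ H₂ : Hypergraph ℕ) : Prop :=
  ∀ e ∈ H₁.edgeSet, ∃ f ∈ H₂.edgeSet, e ⊆ f

def HasTreeProjection (H₁ H₂ : Hypergraph ℕ) : Prop :=
  ∃ Ha : Hypergraph ℕ, IsAcyclic Ha ∧ CoveredBy H₁ Ha ∧ CoveredBy Ha H₂

/-! ## Views and decomposition methods -/

/-- The data of a `v`-structure: a structure `str`, whose relation symbols are the views, and for
the `j`-th tuple of the `i`-th relation of `A` the index `base[i][j]` of its base view. The symbols
of `str` are not identified with those of `A`, so the vocabularies are disjoint. -/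
structure ViewStructure where
  str : RelStructure
  base : List (List ℕ)

/-- The tuple of variables of a view. -/
def RelTable.scope (r : RelTable) : List ℕ := r.tuples.headD []

def ViewStructure.baseView (V : ViewStructure) (i j : ℕ) : Option ℕ :=
  V.base[i]?.bind fun row => row[j]?

def ViewStructure.encode (V : ViewStructure) : List Bool :=
  V.str.encode ++ encList encTuple V.base

theorem prefixCode_viewStructure : PrefixCode ViewStructure.encode := by
  rintro ⟨A, b⟩ ⟨A', b'⟩ s t h
  simp only [ViewStructure.encode, List.append_assoc] at h
  obtain ⟨rfl, h2⟩ := prefixCode_relStructure _ _ _ _ h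
  obtain ⟨rfl, h3⟩ := prefixCode_encNat.list.list _ _ _ _ h2
  exact ⟨rfl, h3⟩

/-- `V` is a `v`-structure for `A`: same domain, one tuple per view, and every constraint of `A`
has a base view with the same tuple of variables. -/
structure IsViewStructure (A : RelStructure) (V : ViewStructure) : Prop where
  card_eq : V.str.card = A.card
  single : ∀ v ∈ V.str.rels, v.tuples.length = 1
  base : ∀ (i j : ℕ) (r : RelTable) (t : List ℕ), A.rels[i]? = some r → r.tuples[j]? = some t →
    ∃ q v, V.baseView i j = some q ∧ V.str.rels[q]? = some v ∧ v.tuples = [t]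

/-- `BV` is legal with respect to `V` and `(A, B)`. -/
structure IsLegal (I : CSPInstance) (V : ViewStructure) (BV : RelStructure) : Prop where
  vocabulary_eq : BV.vocabulary = V.str.vocabulary
  complete : ∀ p ∈ V.str.rels.zip BV.rels, ∀ h ∈ I.solutions p.1.scope, h ∈ p.2.tuples
  base : ∀ (i j q : ℕ) (a b w : RelTable), I.lhs.rels[i]? = some a → I.rhs.rels[i]? = some b →
    j < a.tuples.length → V.baseView i j = some q → BV.rels[q]? = some w →
      ∀ t ∈ w.tuples, t ∈ b.tuples

/-- A decomposition method: a pair of functions, computable by Turing machines in polynomial time,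
that produce a `v`-structure and a legal `r`-structure. -/
structure DecompositionMethod where
  ell : RelStructure → ViewStructure
  r : CSPInstance → RelStructure
  ell_poly : Turing.TM2ComputableInPolyTime RelStructure.encode ViewStructure.encode ell
  r_poly : Turing.TM2ComputableInPolyTime CSPInstance.encode RelStructure.encode r
  ell_view : ∀ A, IsViewStructure A (ell A)
  r_legal : ∀ I, IsLegal I (ell I.lhs) (r I)

/-! ## Computations with a step count

`Timed α` is a result together with the number of elementary steps spent on it. Comparing two
elements, following or building a list cell and testing a bit cost at least one step each. -/

structure Timed (α : Type) where
  val : α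
  steps : ℕ

instance : Monad Timed where
  pure a := ⟨a, 0⟩
  bind x f := ⟨(f x.val).val, x.steps + (f x.val).steps⟩

def tick (k : ℕ) : Timed Unit := ⟨(), k⟩

def eqT (a b : ℕ) : Timed Bool := ⟨a == b, 1⟩

def mapT {α β : Type} (f : α → Timed β) : List α → Timed (List β)
  | [] => ⟨[], 1⟩
  | a :: l => do
    tick 1
    let b ← f a
    let l' ← mapT f l
    pure (b :: l')

def filterT {α : Type} (f : α → Timed Bool) : List α → Timed (List α)
  | [] => ⟨[], 1⟩
  | a :: l => do
    tick 1
    let b ← f a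
    let l' ← filterT f l
    pure (if b then a :: l' else l')

def allT {α : Type} (f : α → Timed Bool) : List α → Timed Bool
  | [] => ⟨true, 1⟩
  | a :: l => do
    tick 1
    let b ← f a
    if b then allT f l else pure false

def anyT {α : Type} (f : α → Timed Bool) : List α → Timed Bool
  | [] => ⟨false, 1⟩
  | a :: l => do
    tick 1
    let b ← f a
    if b then pure true else anyT f l

def appendT {α : Type} (l l' : List α) : Timed (List α) := ⟨l ++ l', l.length + 1⟩

def flatMapT {α β : Type} (f : α → Timed (List β)) : List α → Timed (List β)
  | [] => ⟨[], 1⟩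
  | a :: l => do
    tick 1
    let b ← f a
    let l' ← flatMapT f l
    appendT b l'

def zipT {α β : Type} (l : List α) (l' : List β) : Timed (List (α × β)) :=
  ⟨l.zip l', l.length + l'.length + 1⟩

def rangeT (n : ℕ) : Timed (List ℕ) := ⟨List.range n, n + 1⟩

def lengthT {α : Type} (l : List α) : Timed ℕ := ⟨l.length, l.length + 1⟩

/-- Access to the `i`-th cell of a list. -/
def nthT {α : Type} (l : List α) (i : ℕ) (d : α) : Timed α := ⟨l.getD i d, i + 1⟩

/-- The position of the first element that passes a test. -/
def findT {α : Type} (f : α → Timed Bool) : List α → Timed (Option ℕ)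
  | [] => ⟨none, 1⟩
  | a :: l => do
    tick 1
    let b ← f a
    if b then pure (some 0) else do
      let i ← findT f l
      pure (i.map (· + 1))

def dedupT : List ℕ → Timed (List ℕ)
  | [] => ⟨[], 1⟩
  | a :: l => do
    tick 1
    let l' ← dedupT l
    let b ← anyT (eqT a) l'
    pure (if b then l' else a :: l')

theorem timed_bind_val {α β : Type} (x : Timed α) (f : α → Timed β) :
    (x >>= f).val = (f x.val).val := rfl

theorem timed_pure_val {α : Type} (a : α) : (pure a : Timed α).val = a := rfl

theorem mapT_val {α β : Type} (f : α → Timed β) (l : List α) :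
    (mapT f l).val = l.map fun a => (f a).val := by
  induction l with
  | nil => rfl
  | cons a l ih => simp [mapT, timed_bind_val, timed_pure_val, ih]

theorem filterT_val {α : Type} (f : α → Timed Bool) (l : List α) :
    (filterT f l).val = l.filter fun a => (f a).val := by
  induction l with
  | nil => rfl
  | cons a l ih => simp [filterT, timed_bind_val, timed_pure_val, ih, List.filter_cons]

theorem anyT_val {α : Type} (f : α → Timed Bool) (l : List α) :
    (anyT f l).val = l.any fun a => (f a).val := by
  induction l with
  | nil => rfl
  | cons a l ih =>
    simp only [anyT, timed_bind_val, List.any_cons]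
    cases h : (f a).val <;> simp [timed_pure_val, ih]

theorem flatMapT_val {α β : Type} (f : α → Timed (List β)) (l : List α) :
    (flatMapT f l).val = l.flatMap fun a => (f a).val := by
  induction l with
  | nil => rfl
  | cons a l ih => simp [flatMapT, timed_bind_val, appendT, ih]

theorem mem_dedupT {l : List ℕ} {x : ℕ} : x ∈ (dedupT l).val ↔ x ∈ l := by
  induction l generalizing x with
  | nil => simp [dedupT]
  | cons a l ih =>
    simp only [dedupT, timed_bind_val, timed_pure_val, anyT_val, eqT]
    split_ifs with h
    · simp only [List.any_eq_true, beq_iff_eq] at h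
      obtain ⟨y, hy, rfl⟩ := h
      rw [ih] at hy ⊢
      simp only [List.mem_cons]
      exact ⟨Or.inr, fun h => h.elim (fun e => e ▸ hy) id⟩
    · simp [ih]

theorem nodup_dedupT (l : List ℕ) : (dedupT l).val.Nodup := by
  induction l with
  | nil => simp [dedupT]
  | cons a l ih =>
    simp only [dedupT, timed_bind_val, timed_pure_val, anyT_val, eqT]
    split_ifs with h
    · exact ih
    · simp only [List.any_eq_true, beq_iff_eq, not_exists, not_and] at h
      exact List.nodup_cons.2 ⟨fun ha => h a ha rfl, ih⟩

/-! ## Domain-restricted versions -/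

/-- Is the relation equal to `{⟨X⟩}`? -/
def isDomT (X : ℕ) (r : RelTable) : Timed Bool :=
  match r.tuples with
  | [[y]] => eqT y X
  | _ => ⟨false, 1⟩

/-- The places where `X` occurs in the constraints: all pairs of a relation of `B` and a position
such that some constraint over this relation has `X` at this position of its scope. -/
def occurrencesT (I : CSPInstance) (X : ℕ) : Timed (List (RelTable × ℕ)) := do
  let ps ← zipT I.lhs.rels I.rhs.rels
  flatMapT (fun p => flatMapT (fun t => do
    let ks ← rangeT t.length
    let hits ← filterT (fun k => do let y ← nthT t k 0; eqT y X) ks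
    mapT (fun k => ⟨(p.2, k), 1⟩) hits) p.1.tuples) ps

/-- The values for a fresh domain constraint on `X`, taken from the constraint relation and
position that `pick` selects among those where `X` occurs (all values if it occurs nowhere). -/
def freshDomainT (I : CSPInstance) (pick : ℕ → ℕ) (X : ℕ) : Timed (List ℕ) := do
  let occ ← occurrencesT I X
  tick (occ.length + 1)
  match occ[pick X % occ.length]? with
  | none => rangeT I.rhs.card
  | some (b, k) => do
    let col ← mapT (fun t => nthT t k 0) b.tuples
    dedupT col

theorem freshDomainT_nodup (I : CSPInstance) (pick : ℕ → ℕ) (X : ℕ) :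
    (freshDomainT I pick X).val.Nodup := by
  simp only [freshDomainT, timed_bind_val]
  split
  · exact List.nodup_range
  · exact nodup_dedupT _

theorem freshDomainT_lt (I : CSPInstance) (pick : ℕ → ℕ) (X : ℕ) :
    ∀ x ∈ (freshDomainT I pick X).val, x < I.rhs.card := by
  intro x hx
  simp only [freshDomainT, timed_bind_val] at hx
  split at hx
  · simpa [rangeT] using hx
  · next b k hbk =>
    have hmem := List.mem_of_getElem? hbk
    simp only [occurrencesT, timed_bind_val, flatMapT_val, List.mem_flatMap, filterT_val,
      mapT_val, zipT, rangeT, List.mem_map, List.mem_filter, List.mem_range] at hmem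
    obtain ⟨p, hp, t, ht, k', ⟨hk', -⟩, heq⟩ := hmem
    obtain ⟨rfl, rfl⟩ := Prod.mk.inj heq
    rw [timed_bind_val, mem_dedupT, mapT_val] at hx
    obtain ⟨u, hu, rfl⟩ := List.mem_map.1 hx
    have hpl : p.1 ∈ I.lhs.rels := (List.of_mem_zip hp).1
    have hpr : p.2 ∈ I.rhs.rels := (List.of_mem_zip hp).2
    have har : p.1.arity = p.2.arity := by
      obtain ⟨i, hi, hpi⟩ := List.mem_iff_getElem.1 hp
      have h1 : I.lhs.rels[i]? = some p.1 := by
        rw [List.length_zip] at hi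
        rw [List.getElem?_eq_getElem (by omega), ← hpi, List.getElem_zip]
      have h2 : I.rhs.rels[i]? = some p.2 := by
        rw [List.length_zip] at hi
        rw [List.getElem?_eq_getElem (by omega), ← hpi, List.getElem_zip]
      have h3 := congrArg (fun l => l[i]?) I.same_vocabulary
      simpa [RelStructure.vocabulary, h1, h2] using h3
    have hlen : k' < u.length := by
      rw [((I.rhs.wf _ hpr).2 u hu).1, ← har, ← ((I.lhs.wf _ hpl).2 t ht).1]
      exact hk'
    have : (nthT u k' 0).val = u[k'] := by simp [nthT, hlen]
    rw [this]
    exact ((I.rhs.wf _ hpr).2 u hu).2 _ (List.getElem_mem hlen)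

/-- Adds fresh unary relation symbols, interpreted by the given sets. -/
def RelStructure.addUnary (A : RelStructure) (ds : List (List ℕ))
    (hds : ∀ d ∈ ds, d.Nodup ∧ ∀ x ∈ d, x < A.card) : RelStructure where
  card := A.card
  rels := A.rels ++ ds.map fun d => ⟨1, d.map fun x => [x]⟩
  wf := by
    intro r hr
    rcases List.mem_append.1 hr with h | h
    · exact A.wf r h
    · obtain ⟨d, hd, rfl⟩ := List.mem_map.1 h
      refine ⟨(hds d hd).1.map fun x y hxy => by simpa using hxy, ?_⟩
      intro t ht
      obtain ⟨x, hx, rfl⟩ := List.mem_map.1 ht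
      simpa using (hds d hd).2 x hx

/-- `(A, B)` with a fresh domain constraint for every variable. -/
def CSPInstance.addDomains (I : CSPInstance) (pick : ℕ → ℕ) : CSPInstance where
  lhs := I.lhs.addUnary ((List.range I.lhs.card).map fun X => [X]) (by simp)
  rhs := I.rhs.addUnary (mapT (freshDomainT I pick) (List.range I.lhs.card)).val (by
    intro d hd
    rw [mapT_val] at hd
    obtain ⟨X, -, rfl⟩ := List.mem_map.1 hd
    exact ⟨freshDomainT_nodup I pick X, freshDomainT_lt I pick X⟩)
  same_vocabulary := by
    have h := I.same_vocabulary
    simp only [RelStructure.vocabulary] at h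
    simp [RelStructure.vocabulary, RelStructure.addUnary, h, mapT_val, Function.comp_def]

/-- A domain-restricted version of `(A, B, A)`, together with the list that gives for each variable
`X` the symbol `dom(X)`: the instance itself if every variable is domain restricted already, and
otherwise the instance with a fresh domain constraint for every variable. The steps spent in `new`
and in the two lines after it are those of building `I.addDomains pick`. -/
def domainRestrictedT (I : CSPInstance) (pick : ℕ → ℕ) : Timed (CSPInstance × List ℕ) := do
  let xs ← rangeT I.lhs.card
  let ds ← mapT (fun X => findT (isDomT X) I.lhs.rels) xs
  let ok ← allT (fun d => ⟨d.isSome, 1⟩) ds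
  if ok then do
    let doms ← mapT (fun d => ⟨d.getD 0, 1⟩) ds
    pure (I, doms)
  else do
    let new ← mapT (freshDomainT I pick) xs
    let _ ← mapT (fun d => mapT (fun x => ⟨[x], 1⟩) d) new
    tick (2 * I.lhs.card + I.lhs.rels.length + I.rhs.rels.length)
    let k ← lengthT I.lhs.rels
    let doms ← mapT (fun X => ⟨k + X, 1⟩) xs
    pure (I.addDomains pick, doms)

/-! ## Generalized arc consistency -/

/-- A view with its tuple of variables and its current relation. -/
structure View where
  scope : List ℕ
  tuples : List (List ℕ)

/-- Do the two tuples give the same values to the common variables of the two scopes? -/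
def agreeT (s b s' b' : List ℕ) : Timed Bool := do
  let p ← zipT s b
  let p' ← zipT s' b'
  allT (fun x => allT (fun y => do
    let e ← eqT x.1 y.1
    if e then eqT x.2 y.2 else pure true) p') p

def shareT (s s' : List ℕ) : Timed Bool := anyT (fun x => anyT (eqT x) s') s

/-- Either the views have no variable in common, or some tuple of `v'` agrees with the tuple `b` of
`v`. For `v' = v` this says that `b` gives equal values to equal variables of the scope. -/
def supportedT (v : View) (b : List ℕ) (v' : View) : Timed Bool := do
  let c ← shareT v.scope v'.scope
  if c then anyT (fun b' => agreeT v.scope b v'.scope b') v'.tuples else pure true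

/-- Removes the tuples that lack a support in some view. -/
def filterPassT (S : List View) : Timed (List View) :=
  mapT (fun v => do
    let ts ← filterT (fun b => allT (supportedT v b) S) v.tuples
    pure ⟨v.scope, ts⟩) S

def countT : List View → Timed ℕ
  | [] => ⟨0, 1⟩
  | v :: S => do
    tick 1
    let k ← lengthT v.tuples
    let c ← countT S
    pure (k + c)

/-- Filters until nothing is removed any more (at most `fuel` times). -/
def gacLoopT : ℕ → List View → Timed (List View)
  | 0, S => pure S
  | fuel + 1, S => do
    let c ← countT S
    let S' ← filterPassT S
    let c' ← countT S'
    let e ← eqT c c'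
    if e then pure S' else gacLoopT fuel S'

/-- Enforces generalized arc consistency. -/
def gacT (S : List View) : Timed (List View) := do
  let c ← countT S
  gacLoopT (c + 1) S

/-- Is some view empty? -/
def isEmptyT (S : List View) : Timed Bool := anyT (fun v => ⟨v.tuples.isEmpty, 1⟩) S

/-- The values in the `q`-th view (a domain view). -/
def activeValuesT (q : ℕ) (S : List View) : Timed (List ℕ) := do
  let v ← nthT S q ⟨[], []⟩
  mapT (fun t => nthT t 0 0) v.tuples

/-- Replaces the relation of the `q`-th view by `{⟨a⟩}`. -/
def assignT (q a : ℕ) (S : List View) : Timed (List View) :=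
  ⟨S.modify q (fun v => ⟨v.scope, [[a]]⟩), S.length + 1⟩

/-! ## The algorithm -/

/-- What the algorithm may output: a certified solution, or the failure message. -/
inductive Event where
  | solution (h c : List ℕ)
  | failure

/-- The record of a computation: `none` is an elementary step without output, `some e` is the
output of `e`; `halted` tells whether the whole computation has been stopped. -/
structure Run where
  trace : List (Option Event)
  halted : Bool

/-- First the steps of `x`, then the run that continues with its result. -/
def Run.after {α : Type} (x : Timed α) (k : α → Run) : Run :=
  ⟨List.replicate x.steps none ++ (k x.val).trace, (k x.val).halted⟩

/-- Outputs the certified solution `(⟨a₁, …, a_m⟩, ⟨a_{m+1}, …, a_n⟩)`. -/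
def Run.output (m : ℕ) (a : List ℕ) : Run :=
  ⟨List.replicate (a.length + 1) none ++ [some (.solution (a.take m) (a.drop m))], false⟩

/-- Outputs the failure message and halts. -/
def Run.fail : Run := ⟨[some .failure], true⟩

/-- The loop over a list of values; with `brk` it is left after the first value. -/
def forEach (brk : Bool) (body : ℕ → Run) : List ℕ → Run
  | [] => ⟨[none], false⟩
  | a :: l =>
    let x := body a
    if x.halted || brk then ⟨none :: x.trace, x.halted⟩
    else
      let y := forEach brk body l
      ⟨none :: x.trace ++ y.trace, y.halted⟩

/-- The procedure `CPropagate`. The first list holds the variables `X_i, …, X_n` still to be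
assigned, `pre` the values `a₁, …, a_{i-1}`, and `domView` gives for each variable the index of its
domain view. -/
def cPropagate (domView : List ℕ) (m : ℕ) : List ℕ → ℕ → List View → List ℕ → Run
  | [], _, _, _ => ⟨[], false⟩
  | X :: Xs, i, S, pre =>
    Run.after (gacT S) fun S' =>
    Run.after (isEmptyT S') fun e =>
    if 1 < i ∧ e = true then Run.fail
    else
      Run.after (nthT domView X 0) fun q =>
      Run.after (activeValuesT q S') fun activeValues =>
      forEach (decide (m < i)) (fun a =>
        if Xs = [] then Run.output m (pre ++ [a])
        else
          Run.after (appendT pre [a]) fun pre' =>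
          Run.after (assignT q a S') fun S'' =>
          cPropagate domView m Xs (i + 1) S'' pre') activeValues

/-- The variables of `A` that are not output variables. -/
def ECSPInstance.restT (I : ECSPInstance) : Timed (List ℕ) := do
  let xs ← rangeT I.lhs.card
  filterT (fun x => do
    let b ← anyT (eqT x) I.out
    pure (!b)) xs

/-- A call of `ℓ-DM`: writing the input, the steps of the Turing machine, reading the output. -/
noncomputable def DecompositionMethod.callEll (DM : DecompositionMethod) (A : RelStructure) :
    Timed ViewStructure :=
  ⟨DM.ell A, A.encode.length + (DM.ell_poly.outputsFun A).steps + (DM.ell A).encode.length⟩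

/-- A call of `r-DM`. -/
noncomputable def DecompositionMethod.callR (DM : DecompositionMethod) (I : CSPInstance) :
    Timed RelStructure :=
  ⟨DM.r I, I.encode.length + (DM.r_poly.outputsFun I).steps + (DM.r I).encode.length⟩

/-- The views with their initial relations. -/
def initViewsT (V : ViewStructure) (BV : RelStructure) : Timed (List View) := do
  let ps ← zipT V.str.rels BV.rels
  mapT (fun p => ⟨⟨p.1.scope, p.2.tuples⟩, 1⟩) ps

/-- For each variable the index of its domain view: the base view of the one tuple of `dom(X)`. -/
def domViewsT (V : ViewStructure) (doms : List ℕ) : Timed (List ℕ) :=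
  mapT (fun d => do
    let row ← nthT V.base d []
    nthT row 0 0) doms

/-- The algorithm `ComputeCertifiedSolutions` for the decomposition method `DM`; `pick` resolves
the free choice of a domain-restricted version. -/
noncomputable def computeCertifiedSolutions (DM : DecompositionMethod) (pick : ℕ → ℕ)
    (I : ECSPInstance) : Run :=
  Run.after I.restT fun rest =>
  Run.after (appendT I.out rest) fun vars =>
  Run.after (lengthT I.out) fun m =>
  Run.after (domainRestrictedT I.toCSPInstance pick) fun D =>
  Run.after (DM.callEll D.1.lhs) fun V =>
  Run.after (DM.callR D.1) fun BV =>
  Run.after (initViewsT V BV) fun S =>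
  Run.after (domViewsT V D.2) fun domView =>
  cPropagate domView m vars 1 S []

/-- The hypergraph of the views that the algorithm works with: that of `ℓ-DM` applied to the
domain-restricted version of the input. -/
def DecompositionMethod.viewHypergraph (DM : DecompositionMethod) (pick : ℕ → ℕ)
    (I : ECSPInstance) : Hypergraph ℕ :=
  (DM.ell (domainRestrictedT I.toCSPInstance pick).val.1.lhs).str.hypergraph

/-! ## What is claimed about a run -/

/-- The outputs of a run, in order. -/
def Run.outputs (R : Run) : List Event := R.trace.reduceOption

/-- The projected solutions that a run outputs, in order. -/
def Run.projected (R : Run) : List (List ℕ) :=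
  R.outputs.filterMap fun e =>
    match e with
    | .solution h _ => some h
    | .failure => none

/-- At most `d` steps pass before the first output, between two consecutive outputs, and from the
last output until the end of the computation. -/
def Run.HasDelay (R : Run) (d : ℕ) : Prop :=
  ∀ (l₁ l₂ : List (Option Event)) (k : ℕ), R.trace = l₁ ++ List.replicate k none ++ l₂ → k ≤ d

/-- `c` extends the values `h` of the output variables to a full solution: some homomorphism takes
the values `h` on the output variables and the values `c` on the other variables. -/
def ECSPInstance.IsCertificate (I : ECSPInstance) (h c : List ℕ) : Prop :=
  ∃ g, IsHom I.lhs I.rhs g ∧ I.out.map g = h ∧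
    ((List.range I.lhs.card).filter (fun x => x ∉ I.out)).map g = c

end CertEnum

/-! Soundness needs no tree projection. When the last variable receives a value, the domain views of
all earlier variables hold at most one tuple. By arc consistency every tuple of a base view agrees
with these, and a tuple that supports the last value agrees with that value too. So every base view
contains the restriction of the assembled assignment, and since base views lie inside the constraint
relations, the assignment is a homomorphism (`SearchState.exists_solution`). The emptiness test
supplies a tuple in those base views that avoid the last variable.

Completeness, absent failure: filtering never deletes the restriction of a homomorphism
(`Contains.gacT`), so on the first `m` levels the search can follow any given homomorphism. Deeper,
any value will do: a later call that does not fail has a value to try, so an output with the right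
first `m` values is reached (`SearchState.mem_projected`). Branches on the first `m` levels differ
in a coordinate of the projected solution, and deeper levels have a single branch, so nothing is
output twice.

Failure: suppose there is a tree projection. In arc consistent views a single value of one variable
forces, by connectedness, every view with a variable to be non-empty. Matching tuples are then
chosen hyperedge by hyperedge along the join tree (`exists_choice_of_joinTree`) and glue to a
homomorphism with the given value (`extendable_of_hasTreeProjection`). Hence every partial
assignment reached extends to a homomorphism, and this homomorphism keeps all views non-empty
(`SearchState.no_failure`). An instance with one variable is treated apart; there the failure test
never applies.

Delay: every call after the first produces an output, so between outputs the recursion unwinds at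
most once and descends at most once, through at most `n` levels of polynomial cost
(`SearchState.gap`). The cost is polynomial in the input because a machine pushes boundedly many
symbols per step, so the view structures have polynomial size (`exists_output_length_le`). -/

namespace CertEnum

/-! ## The output of a polynomial-time machine has polynomial length -/

section Machine

open Turing

variable {K : Type} {Γ : K → Type} {Λ σ : Type}

/-- The largest number of symbols that a statement can push. -/
def pushCount : TM2.Stmt Γ Λ σ → ℕ
  | .push _ _ q => pushCount q + 1
  | .peek _ _ q => pushCount q
  | .pop _ _ q => pushCount q
  | .load _ q => pushCount q
  | .branch _ q₁ q₂ => max (pushCount q₁) (pushCount q₂)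
  | .goto _ => 0
  | .halt => 0

/-- Every push is charged to every stack. The estimate is crude, but only its independence of the
input matters. -/
theorem stepAux_stk_length [DecidableEq K] (q : TM2.Stmt Γ Λ σ) :
    ∀ (v : σ) (S : ∀ k, List (Γ k)) (n : ℕ), (∀ k, (S k).length ≤ n) →
      ∀ k, ((TM2.stepAux q v S).stk k).length ≤ n + pushCount q := by
  induction q with
  | push k f q ih =>
    intro v S n h k'
    have := ih v (Function.update S k (f v :: S k)) (n + 1) (by
      intro j
      by_cases hj : j = k
      · subst hj; simpa using h j
      · simpa [Function.update_of_ne hj] using (h j).trans (Nat.le_succ n)) k'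
    simp only [TM2.stepAux, pushCount]
    omega
  | peek k f q ih => intro v S n h k'; exact ih _ _ n h k'
  | pop k f q ih =>
    intro v S n h k'
    refine ih _ _ n ?_ k'
    intro j
    by_cases hj : j = k
    · subst hj; have := h j; simp; omega
    · simpa [Function.update_of_ne hj] using h j
  | load a q ih => intro v S n h k'; exact ih _ _ n h k'
  | branch f q₁ q₂ ih₁ ih₂ =>
    intro v S n h k'
    have h₁ := ih₁ v S n h k'
    have h₂ := ih₂ v S n h k'
    simp only [TM2.stepAux, pushCount]
    cases f v <;> simp only [cond_true, cond_false] <;> omega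
  | goto f => intro v S n h k'; simpa [TM2.stepAux, pushCount] using h k'
  | halt => intro v S n h k'; simpa [TM2.stepAux, pushCount] using h k'

theorem iterate_bind_none {α : Type} (f : α → Option α) (t : ℕ) :
    (flip bind f)^[t] none = none := by
  induction t with
  | zero => rfl
  | succ t ih => rw [Function.iterate_succ_apply]; exact ih

theorem iterate_step_stk_length [DecidableEq K] (M : Λ → TM2.Stmt Γ Λ σ) (m : ℕ)
    (hm : ∀ l, pushCount (M l) ≤ m) (t : ℕ) :
    ∀ (c c' : TM2.Cfg Γ Λ σ) (n : ℕ), (∀ k, (c.stk k).length ≤ n) →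
      (flip bind (TM2.step M))^[t] (some c) = some c' → ∀ k, (c'.stk k).length ≤ n + t * m := by
  induction t with
  | zero =>
    intro c c' n h he k
    obtain rfl : c = c' := by simpa using he
    simpa using h k
  | succ t ih =>
    intro c c' n h he k
    rw [Function.iterate_succ_apply] at he
    obtain ⟨l, v, S⟩ := c
    cases l with
    -- A halted configuration has no successor, so it cannot occur before the last step.
    | none =>
      have : flip bind (TM2.step M) (some ⟨none, v, S⟩) = none := rfl
      rw [this, iterate_bind_none] at he
      cases he
    | some l =>
      have h1 : flip bind (TM2.step M) (some ⟨some l, v, S⟩) = some (TM2.stepAux (M l) v S) := rfl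
      rw [h1] at he
      have := ih _ c' (n + m)
        (fun k => (stepAux_stk_length (M l) v S n h k).trans (by have := hm l; omega)) he k
      rw [Nat.succ_mul]
      omega

/-- At the end the output occupies a stack. No stack starts longer than the input, and there are
finitely many labels, hence a uniform bound `m` on the growth per step. -/
theorem exists_output_length_le {α β : Type} {ea : α → List Bool} {eb : β → List Bool} {f : α → β}
    (h : TM2ComputableInPolyTime ea eb f) :
    ∃ m : ℕ, ∀ a, (eb (f a)).length ≤ (ea a).length + h.time.eval (ea a).length * m := by
  have := h.tm.ΛFin
  refine ⟨Finset.univ.sup fun l => pushCount (h.tm.m l), fun a => ?_⟩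
  set m := Finset.univ.sup fun l => pushCount (h.tm.m l)
  have ho := h.outputsFun a
  have hi : ∀ k, ((initList h.tm ((ea a).map h.inputAlphabet.invFun)).stk k).length
      ≤ (ea a).length := by
    intro k
    by_cases hk : k = h.tm.k₀
    · subst hk; simp [initList]
    · simp [initList, hk]
  have := iterate_step_stk_length h.tm.m m
    (fun l => Finset.le_sup (f := fun l => pushCount (h.tm.m l)) (Finset.mem_univ l)) ho.steps _ _ _ hi
    ho.evals_in_steps h.tm.k₁
  have h2 : ((haltList h.tm ((eb (f a)).map h.outputAlphabet.invFun)).stk h.tm.k₁).length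
      = (eb (f a)).length := by
    simp [haltList]
  rw [h2] at this
  exact this.trans (by gcongr; exact ho.steps_le_m)

end Machine

/-! ## Extending local choices along a join tree -/

section JoinTree

variable {V β : Type} {T : SimpleGraph V}

/-- Carries a value along a walk, changing it at every step as `c` says. -/
def transport (c : V → V → β → β) : ∀ {u v : V}, T.Walk u v → β → β
  | _, _, .nil, b => b
  | u, _, .cons (v := w) _ p, b => transport c p (c u w b)

theorem transport_concat (c : V → V → β → β) {u v w : V} (p : T.Walk u v) (h : T.Adj v w) (b : β) :
    transport c (p.concat h) b = c v w (transport c p b) := by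
  induction p generalizing b with
  | nil => rfl
  | cons _ p ih => exact ih h _

theorem transport_property (c : V → V → β → β) {P : V → β → Prop}
    (hc : ∀ u v b, P u b → P v (c u v b)) {u v : V} (p : T.Walk u v) (b : β) (hb : P u b) :
    P v (transport c p b) := by
  induction p generalizing b with
  | nil => exact hb
  | cons _ p ih => exact ih _ (hc _ _ _ hb)

/-- The choice at each vertex is carried there from the root along the unique path. Neighbours agree
because one of them received its choice from the other; two distant vertices containing `x` agree on
`x` because the join-tree property keeps `x` in every vertex between them. -/
theorem exists_choice_of_joinTree {β : Type} (hT : T.Preconnected) (hac : T.IsAcyclic)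
    (mem : ℕ → V → Prop)
    (hjt : ∀ x e f, mem x e → mem x f → ∀ q : T.Walk e f, q.IsPath → ∀ k ∈ q.support, mem x k)
    (P : V → (ℕ → β) → Prop)
    (step : ∀ e f g, P e g → ∃ g', P f g' ∧ ∀ x, mem x e → mem x f → g x = g' x)
    (r : V) (g₀ : ℕ → β) (h₀ : P r g₀) :
    ∃ G : V → ℕ → β, G r = g₀ ∧ (∀ e, P e (G e)) ∧
      ∀ x e f, mem x e → mem x f → G e x = G f x := by
  classical
  choose! c hc hc' using step
  choose w hw using fun v => (hT r v).exists_isPath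
  let G : V → ℕ → β := fun v => transport c (w v) g₀
  have hP : ∀ v, P v (G v) := fun v => transport_property c hc (w v) g₀ h₀
  have huniq : ∀ {u v : V} (p q : T.Walk u v), p.IsPath → q.IsPath → p = q := fun p q hp hq =>
    congrArg Subtype.val (hac.subsingleton_path _ _ |>.elim ⟨p, hp⟩ ⟨q, hq⟩)
  have hadj : ∀ u v, T.Adj u v → ∀ x, mem x u → mem x v → G u x = G v x := by
    intro u v huv x hu hv
    by_cases hs : u ∈ (w v).support
    · have : G v = c u v (G u) := by
        change transport c (w v) g₀ = _
        rw [hac.path_concat (hw u) (hw v) huv hs, transport_concat]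
      rw [this]
      exact hc' u v (G u) (hP u) x hu hv
    · have hv' := hac.mem_support_of_ne_mem_support_of_adj_of_isPath (hw u) (hw v) huv hs
      have : G u = c v u (G v) := by
        change transport c (w u) g₀ = _
        rw [hac.path_concat (hw v) (hw u) huv.symm hv', transport_concat]
      rw [this]
      exact (hc' v u (G v) (hP v) x hv hu).symm
  have hwalk : ∀ x, ∀ e f, ∀ q : T.Walk e f, (∀ k ∈ q.support, mem x k) → G e x = G f x := by
    intro x e f q
    induction q with
    | nil => intro _; rfl
    | cons h p ih =>
      intro hk
      rw [hadj _ _ h x (hk _ (by simp)) (hk _ (by simp))]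
      exact ih fun k hk' => hk k (by simp [hk'])
  refine ⟨G, ?_, hP, fun x e f he hf => ?_⟩
  · change transport c (w r) g₀ = _
    rw [huniq (w r) .nil (hw r) SimpleGraph.Walk.IsPath.nil]
    rfl
  · obtain ⟨q, hq⟩ := (hT e f).exists_isPath
    exact hwalk x e f q (hjt x e f he hf q hq)

end JoinTree

/-! ## Generalized arc consistency -/

theorem allT_val {α : Type} (f : α → Timed Bool) (l : List α) :
    (allT f l).val = l.all fun a => (f a).val := by
  induction l with
  | nil => rfl
  | cons a l ih =>
    simp only [allT, timed_bind_val, List.all_cons]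
    cases h : (f a).val <;> simp [timed_pure_val, ih]

/-- The tuples `b` along `s` and `b'` along `s'` give the same values to common variables. -/
def Agree (s b s' b' : List ℕ) : Prop :=
  ∀ x ∈ s.zip b, ∀ y ∈ s'.zip b', x.1 = y.1 → x.2 = y.2

def Share (s s' : List ℕ) : Prop := ∃ x ∈ s, x ∈ s'

def Supported (v : View) (b : List ℕ) (v' : View) : Prop :=
  Share v.scope v'.scope → ∃ b' ∈ v'.tuples, Agree v.scope b v'.scope b'

theorem agreeT_val {s b s' b' : List ℕ} : (agreeT s b s' b').val = true ↔ Agree s b s' b' := by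
  simp only [agreeT, timed_bind_val, allT_val, List.all_eq_true, zipT, eqT, Agree]
  refine forall₂_congr fun x _ => forall₂_congr fun y _ => ?_
  by_cases h : x.1 = y.1 <;> simp [h, timed_pure_val]

theorem shareT_val {s s' : List ℕ} : (shareT s s').val = true ↔ Share s s' := by
  simp [shareT, anyT_val, eqT, Share]

theorem supportedT_val {v v' : View} {b : List ℕ} :
    (supportedT v b v').val = true ↔ Supported v b v' := by
  simp only [supportedT, timed_bind_val, Supported]
  by_cases h : Share v.scope v'.scope
  · rw [if_pos (shareT_val.2 h)]
    simp [anyT_val, agreeT_val, h]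
  · rw [if_neg (by rwa [shareT_val])]
    simp [h, timed_pure_val]

open Classical in
theorem filterPassT_val (S : List View) :
    (filterPassT S).val =
      S.map fun v => ⟨v.scope, v.tuples.filter fun b => ∀ v' ∈ S, Supported v b v'⟩ := by
  simp only [filterPassT, mapT_val, timed_bind_val, timed_pure_val, filterT_val, allT_val]
  refine List.map_congr_left fun v _ => ?_
  congr 1
  refine List.filter_congr fun b _ => ?_
  rw [Bool.eq_iff_iff]
  simp [supportedT_val]

/-- The views in `S'` are those in `S`, with fewer tuples. -/
def SubViews (S' S : List View) : Prop :=
  List.Forall₂ (fun v' v => v'.scope = v.scope ∧ v'.tuples.Sublist v.tuples) S' S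

theorem SubViews.refl (S : List View) : SubViews S S :=
  List.forall₂_same.2 fun _ _ => ⟨rfl, List.Sublist.refl _⟩

theorem SubViews.trans {S₁ S₂ S₃ : List View} (h : SubViews S₁ S₂) (h' : SubViews S₂ S₃) :
    SubViews S₁ S₃ := by
  unfold SubViews at *
  induction h generalizing S₃ with
  | nil => exact h'
  | cons ha _ ih =>
    cases h' with
    | cons hb hl => exact .cons ⟨ha.1.trans hb.1, ha.2.trans hb.2⟩ (ih hl)

theorem SubViews.getElem? {S' S : List View} (h : SubViews S' S) {q : ℕ} {v' : View}
    (hq : S'[q]? = some v') :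
    ∃ v, S[q]? = some v ∧ v'.scope = v.scope ∧ v'.tuples.Sublist v.tuples := by
  unfold SubViews at h
  induction h generalizing q with
  | nil => simp at hq
  | cons ha _ ih =>
    cases q with
    | zero => obtain rfl : _ = v' := by simpa using hq
              exact ⟨_, by simp, ha⟩
    | succ q => simpa using ih (by simpa using hq)

theorem SubViews.getElem?' {S' S : List View} (h : SubViews S' S) {q : ℕ} {v : View}
    (hq : S[q]? = some v) :
    ∃ v', S'[q]? = some v' ∧ v'.scope = v.scope ∧ v'.tuples.Sublist v.tuples := by
  have hl : S'.length = S.length := List.Forall₂.length_eq h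
  have hq' : q < S'.length := hl ▸ (List.getElem?_eq_some_iff.1 hq).1
  obtain ⟨v₂, hv₂, hs⟩ := h.getElem? (List.getElem?_eq_getElem hq')
  rw [hq] at hv₂
  obtain rfl : v = v₂ := by simpa using hv₂
  exact ⟨_, List.getElem?_eq_getElem hq', hs⟩

theorem SubViews.exists_of_mem {S' S : List View} (h : SubViews S' S) {v' : View} (hv : v' ∈ S') :
    ∃ v ∈ S, v'.scope = v.scope ∧ v'.tuples.Sublist v.tuples := by
  obtain ⟨q, hq⟩ := List.mem_iff_getElem?.1 hv
  obtain ⟨v, hv, hs⟩ := h.getElem? hq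
  exact ⟨v, List.mem_of_getElem? hv, hs⟩

theorem filterPassT_subViews (S : List View) : SubViews (filterPassT S).val S := by
  rw [filterPassT_val]
  refine List.forall₂_map_left_iff.2 (List.forall₂_same.2 fun v _ => ⟨rfl, List.filter_sublist⟩)

theorem countT_val (S : List View) : (countT S).val = (S.map fun v => v.tuples.length).sum := by
  induction S with
  | nil => rfl
  | cons v S ih => simp [countT, timed_bind_val, timed_pure_val, lengthT, ih]

theorem SubViews.countT_le {S' S : List View} (h : SubViews S' S) :
    (countT S').val ≤ (countT S).val := by
  rw [countT_val, countT_val]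
  unfold SubViews at h
  induction h with
  | nil => simp
  | cons ha _ ih =>
    have := ha.2.length_le
    simp only [List.map_cons, List.sum_cons]
    omega

/-- A sublist of the same length is the whole list, so the total number of tuples detects whether a
pass removed anything. -/
theorem SubViews.eq_of_countT {S' S : List View} (h : SubViews S' S)
    (hc : (countT S').val = (countT S).val) : S' = S := by
  unfold SubViews at h
  induction h with
  | nil => rfl
  | @cons a b l l' ha hl ih =>
    have h1 := ha.2.length_le
    have h2 := SubViews.countT_le hl
    rw [countT_val, countT_val] at *
    simp only [List.map_cons, List.sum_cons] at hc
    rw [ih (by omega)]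
    have ht := ha.2.eq_of_length (by omega)
    obtain ⟨s, t⟩ := a
    obtain ⟨s', t'⟩ := b
    obtain rfl : t = t' := ht
    obtain rfl : s = s' := ha.1
    rfl

/-- Every tuple of every view has a support in every view. -/
def ArcConsistent (S : List View) : Prop :=
  ∀ v ∈ S, ∀ b ∈ v.tuples, ∀ v' ∈ S, Supported v b v'

theorem arcConsistent_of_filterPassT_eq {S : List View} (h : (filterPassT S).val = S) :
    ArcConsistent S := by
  classical
  rw [filterPassT_val] at h
  intro v hv b hb
  have hm : ∀ w ∈ S, w.tuples.filter (fun b => ∀ v' ∈ S, Supported w b v') = w.tuples := by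
    intro w hw
    have h' : S.map (fun v : View =>
        (⟨v.scope, v.tuples.filter fun b => ∀ v' ∈ S, Supported v b v'⟩ : View)) = S.map id := by
      rw [h, List.map_id]
    exact congrArg View.tuples (List.map_inj_left.1 h' w hw)
  rw [← hm v hv] at hb
  simpa using (List.mem_filter.1 hb).2

/-- The assignment `g` is allowed by all views. -/
def Contains (S : List View) (g : ℕ → ℕ) : Prop := ∀ v ∈ S, v.scope.map g ∈ v.tuples

theorem forall_mem_zip_map {s : List ℕ} {g : ℕ → ℕ} : ∀ x ∈ s.zip (s.map g), x.2 = g x.1 := by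
  induction s with
  | nil => simp
  | cons a s ih => simpa using ih

/-- The restrictions of one assignment to the various scopes support one another. -/
theorem Contains.filterPassT {S : List View} {g : ℕ → ℕ} (h : Contains S g) :
    Contains (filterPassT S).val g := by
  rw [filterPassT_val]
  intro v hv
  obtain ⟨w, hw, rfl⟩ := List.mem_map.1 hv
  refine List.mem_filter.2 ⟨h w hw, ?_⟩
  simp only [decide_eq_true_eq]
  refine fun v' hv' _ => ⟨_, h v' hv', fun x hx y hy hxy => ?_⟩
  rw [forall_mem_zip_map x hx, forall_mem_zip_map y hy, hxy]

theorem gacLoopT_subViews (k : ℕ) (S : List View) : SubViews (gacLoopT k S).val S := by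
  induction k generalizing S with
  | zero => exact SubViews.refl S
  | succ k ih =>
    simp only [gacLoopT, timed_bind_val]
    split_ifs
    · exact filterPassT_subViews S
    · exact (ih _).trans (filterPassT_subViews S)

theorem gacT_subViews (S : List View) : SubViews (gacT S).val S := gacLoopT_subViews _ S

/-- A pass that does not reach a fixed point removes a tuple, so fuel exceeding the number of tuples
cannot run out. -/
theorem gacLoopT_arcConsistent (k : ℕ) (S : List View) (hk : (countT S).val < k) :
    ArcConsistent (gacLoopT k S).val := by
  induction k generalizing S with
  | zero => omega
  | succ k ih =>
    simp only [gacLoopT, timed_bind_val]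
    have hs := filterPassT_subViews S
    split_ifs with h
    · have he : (filterPassT S).val = S := hs.eq_of_countT (Eq.symm (by simpa [eqT] using h))
      change ArcConsistent (filterPassT S).val
      rw [he]
      exact arcConsistent_of_filterPassT_eq he
    · refine ih _ ?_
      have h1 := hs.countT_le
      have h2 : (countT S).val ≠ (countT (filterPassT S).val).val := by simpa [eqT] using h
      omega

theorem gacT_arcConsistent (S : List View) : ArcConsistent (gacT S).val :=
  gacLoopT_arcConsistent _ S (Nat.lt_succ_self _)

theorem Contains.gacLoopT {S : List View} {g : ℕ → ℕ} (h : Contains S g) (k : ℕ) :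
    Contains (gacLoopT k S).val g := by
  induction k generalizing S with
  | zero => exact h
  | succ k ih =>
    simp only [CertEnum.gacLoopT, timed_bind_val]
    split_ifs
    · exact h.filterPassT
    · exact ih h.filterPassT

theorem Contains.gacT {S : List View} {g : ℕ → ℕ} (h : Contains S g) :
    Contains (gacT S).val g := h.gacLoopT _

theorem isEmptyT_val {S : List View} :
    (isEmptyT S).val = true ↔ ∃ v ∈ S, v.tuples = [] := by
  simp [isEmptyT, anyT_val]

/-! ### Tuples of arc consistent views as restrictions of assignments -/

/-- All tuples have the length of the scope. -/
def WellShaped (S : List View) : Prop := ∀ v ∈ S, ∀ b ∈ v.tuples, b.length = v.scope.length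

theorem WellShaped.subViews {S' S : List View} (h : WellShaped S) (hs : SubViews S' S) :
    WellShaped S' := by
  intro v' hv' b hb
  obtain ⟨v, hv, he, ht⟩ := hs.exists_of_mem hv'
  rw [he]
  exact h v hv b (ht.subset hb)

theorem exists_map_eq_of_agree {s b : List ℕ} (hl : b.length = s.length) (h : Agree s b s b) :
    ∃ g : ℕ → ℕ, s.map g = b := by
  -- The value is read at the first occurrence of `x`; self-agreement gives the same value at its
  -- other occurrences.
  refine ⟨fun x => b.getD (s.idxOf x) 0, ?_⟩
  refine List.ext_getElem (by simp [hl]) fun i h1 h2 => ?_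
  have hi : i < s.length := by simpa using h1
  have hj : s.idxOf s[i] < s.length := List.idxOf_lt_length_iff.2 (List.getElem_mem hi)
  have hjb : s.idxOf s[i] < b.length := by omega
  rw [List.getElem_map, List.getD_eq_getElem _ _ hjb]
  have hm : ∀ k (hk : k < s.length) (hk' : k < b.length), (s[k], b[k]) ∈ s.zip b := fun k hk hk' =>
    List.mem_iff_getElem.2 ⟨k, by simp; omega, by simp⟩
  exact h _ (hm _ hj hjb) _ (hm i hi h2) (by simp)

theorem agree_map_iff {s s' : List ℕ} {g g' : ℕ → ℕ} :
    Agree s (s.map g) s' (s'.map g') ↔ ∀ x ∈ s, x ∈ s' → g x = g' x := by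
  have hm : ∀ (t : List ℕ) (f : ℕ → ℕ) x, x ∈ t → (x, f x) ∈ t.zip (t.map f) := by
    intro t f x hx
    obtain ⟨k, hk, rfl⟩ := List.mem_iff_getElem.1 hx
    exact List.mem_iff_getElem.2 ⟨k, by simpa using hk, by simp⟩
  constructor
  · intro h x hx hx'
    exact h _ (hm s g x hx) _ (hm s' g' x hx') rfl
  · intro h x hx y hy hxy
    rw [forall_mem_zip_map x hx, forall_mem_zip_map y hy, ← hxy]
    exact h _ (List.of_mem_zip hx).1 (hxy ▸ (List.of_mem_zip hy).1)

/-- The support of `b` in its own view has to equal `b` position by position, so `b` agrees with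
itself on repeated variables. A view with empty scope shares no variable with itself and is handled
separately. -/
theorem ArcConsistent.exists_map_eq {S : List View} (h : ArcConsistent S) (hw : WellShaped S)
    {v : View} (hv : v ∈ S) {b : List ℕ} (hb : b ∈ v.tuples) :
    ∃ g : ℕ → ℕ, v.scope.map g = b := by
  by_cases hs : v.scope = []
  · have := hw v hv b hb
    rw [hs] at this
    exact ⟨id, by rw [hs, List.length_eq_zero_iff.1 this]; rfl⟩
  obtain ⟨x, hx⟩ := List.exists_mem_of_ne_nil _ hs
  obtain ⟨b', hb', ha⟩ := h v hv b hb v hv ⟨x, hx, hx⟩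
  have hlb := hw v hv b hb
  have hlb' := hw v hv b' hb'
  have hbb : ∀ i (h₁ : i < v.scope.length), (v.scope[i], b[i]'(by omega)) ∈ v.scope.zip b ∧
      (v.scope[i], b'[i]'(by omega)) ∈ v.scope.zip b' := fun i h₁ =>
    ⟨List.mem_iff_getElem.2 ⟨i, by simp; omega, by simp⟩,
      List.mem_iff_getElem.2 ⟨i, by simp; omega, by simp⟩⟩
  have heq : b = b' := by
    refine List.ext_getElem (by omega) fun i h₁ h₂ => ?_
    exact ha _ (hbb i (by omega)).1 _ (hbb i (by omega)).2 rfl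
  subst heq
  exact exists_map_eq_of_agree hlb ha

theorem ArcConsistent.exists_support {S : List View} (h : ArcConsistent S) (hw : WellShaped S)
    {v v' : View} (hv : v ∈ S) (hv' : v' ∈ S) {g : ℕ → ℕ} (hg : v.scope.map g ∈ v.tuples)
    (hs : Share v.scope v'.scope) :
    ∃ g' : ℕ → ℕ, v'.scope.map g' ∈ v'.tuples ∧ ∀ x ∈ v.scope, x ∈ v'.scope → g x = g' x := by
  obtain ⟨b', hb', ha⟩ := h v hv _ hg v' hv' hs
  obtain ⟨g', rfl⟩ := h.exists_map_eq hw hv' hb'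
  exact ⟨g', hb', agree_map_iff.1 ha⟩

/-! ## Outputs of runs -/

theorem Run.after_outputs {α : Type} (x : Timed α) (k : α → Run) :
    (Run.after x k).outputs = (k x.val).outputs := by
  simp [Run.after, Run.outputs, List.reduceOption_append]

theorem Run.after_halted {α : Type} (x : Timed α) (k : α → Run) :
    (Run.after x k).halted = (k x.val).halted := rfl

theorem Run.output_outputs (m : ℕ) (a : List ℕ) :
    (Run.output m a).outputs = [.solution (a.take m) (a.drop m)] := by
  simp [Run.output, Run.outputs, List.reduceOption_append]

theorem Run.mem_projected {R : Run} {h : List ℕ} :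
    h ∈ R.projected ↔ ∃ c, Event.solution h c ∈ R.outputs := by
  simp only [Run.projected, List.mem_filterMap]
  constructor
  · rintro ⟨e, he, h'⟩
    cases e with
    | solution h₁ c =>
      obtain rfl : h₁ = h := by simpa using h'
      exact ⟨c, he⟩
    | failure => simp at h'
  · rintro ⟨c, hc⟩
    exact ⟨_, hc, rfl⟩

theorem forEach_outputs_cons (brk : Bool) (body : ℕ → Run) (a : ℕ) (l : List ℕ) :
    (forEach brk body (a :: l)).outputs =
      if ((body a).halted || brk) = true then (body a).outputs
      else (body a).outputs ++ (forEach brk body l).outputs := by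
  simp only [forEach]
  split_ifs <;> simp [Run.outputs, List.reduceOption_append]

theorem forEach_outputs_nil (brk : Bool) (body : ℕ → Run) : (forEach brk body []).outputs = [] := by
  simp [forEach, Run.outputs]

theorem forEach_outputs_subset {brk : Bool} {body : ℕ → Run} {l : List ℕ} {e : Event}
    (h : e ∈ (forEach brk body l).outputs) : ∃ a ∈ l, e ∈ (body a).outputs := by
  induction l with
  | nil => simp [forEach_outputs_nil] at h
  | cons a l ih =>
    rw [forEach_outputs_cons] at h
    split_ifs at h
    · exact ⟨a, by simp, h⟩
    · rcases List.mem_append.1 h with h | h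
      · exact ⟨a, by simp, h⟩
      · obtain ⟨b, hb, hb'⟩ := ih h
        exact ⟨b, by simp [hb], hb'⟩

theorem forEach_halted {brk : Bool} {body : ℕ → Run} {l : List ℕ}
    (hb : ∀ a, (body a).halted = true → Event.failure ∈ (body a).outputs)
    (h : (forEach brk body l).halted = true) :
    Event.failure ∈ (forEach brk body l).outputs := by
  induction l with
  | nil => simp [forEach] at h
  | cons a l ih =>
    rw [forEach_outputs_cons]
    simp only [forEach] at h
    split_ifs at h ⊢
    · exact hb a h
    · exact List.mem_append_right _ (ih h)

/-- Without the break, the loop stops early only when a body halts, which leaves a failure message.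
In its absence every value is visited. -/
theorem mem_forEach_outputs {body : ℕ → Run} {l : List ℕ}
    (hb : ∀ a, (body a).halted = true → Event.failure ∈ (body a).outputs)
    (hf : Event.failure ∉ (forEach false body l).outputs) {a : ℕ} (ha : a ∈ l) {e : Event}
    (he : e ∈ (body a).outputs) : e ∈ (forEach false body l).outputs := by
  induction l with
  | nil => simp at ha
  | cons b l ih =>
    rw [forEach_outputs_cons] at hf ⊢
    split_ifs at hf ⊢ with h
    · exact absurd (hb b (by simpa using h)) hf
    · simp only [List.mem_append, not_or] at hf ⊢
      rcases List.mem_cons.1 ha with rfl | ha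
      · exact Or.inl he
      · exact Or.inr (ih hf.2 ha)

/-- With the break only one body runs, so bodies need to be disjoint only when `brk` is false. -/
theorem forEach_projected_nodup {brk : Bool} {body : ℕ → Run} {l : List ℕ} (hl : l.Nodup)
    (hb : ∀ a ∈ l, (body a).projected.Nodup)
    (hd : brk = false → ∀ a ∈ l, ∀ b ∈ l, ∀ h ∈ (body a).projected, h ∈ (body b).projected → a = b) :
    (forEach brk body l).projected.Nodup := by
  induction l with
  | nil => simp [Run.projected, forEach_outputs_nil]
  | cons a l ih =>
    have h1 := hb a (by simp)
    rw [Run.projected, forEach_outputs_cons]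
    split_ifs with h
    · exact h1
    · have hbrk : brk = false := by
        cases brk <;> simp_all
      rw [List.filterMap_append]
      refine List.nodup_append.2 ⟨h1, ih (List.nodup_cons.1 hl).2 (fun b hb' => hb b (by simp [hb']))
        (fun _ b hb' c hc => hd hbrk b (by simp [hb']) c (by simp [hc])), ?_⟩
      rintro x hx _ hy rfl
      obtain ⟨c, hc⟩ := Run.mem_projected.1 (show x ∈ (forEach brk body l).projected from hy)
      obtain ⟨b, hb', hc'⟩ := forEach_outputs_subset hc
      have := hd hbrk a (by simp) b (by simp [hb']) x hx (Run.mem_projected.2 ⟨c, hc'⟩)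
      subst this
      exact (List.nodup_cons.1 hl).1 hb'

/-- The body of the loop of `cPropagate`. -/
def branch (dv : List ℕ) (m X : ℕ) (Xs : List ℕ) (i : ℕ) (S : List View) (pre : List ℕ) (a : ℕ) :
    Run :=
  if Xs = [] then Run.output m (pre ++ [a])
  else
    Run.after (appendT pre [a]) fun pre' =>
    Run.after (assignT (dv.getD X 0) a S) fun S'' =>
    cPropagate dv m Xs (i + 1) S'' pre'

theorem branch_nil (dv : List ℕ) (m X i : ℕ) (S : List View) (pre : List ℕ) (a : ℕ) :
    branch dv m X [] i S pre a = Run.output m (pre ++ [a]) := by simp [branch]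

theorem branch_outputs {dv : List ℕ} {m X : ℕ} {Xs : List ℕ} {i : ℕ} {S : List View}
    {pre : List ℕ} {a : ℕ} (h : Xs ≠ []) :
    (branch dv m X Xs i S pre a).outputs =
      (cPropagate dv m Xs (i + 1) (assignT (dv.getD X 0) a S).val (pre ++ [a])).outputs := by
  rw [branch, if_neg h, Run.after_outputs, Run.after_outputs]
  rfl

theorem cPropagate_cons (dv : List ℕ) (m X : ℕ) (Xs : List ℕ) (i : ℕ) (S : List View)
    (pre : List ℕ) :
    cPropagate dv m (X :: Xs) i S pre =
      Run.after (gacT S) fun S' =>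
      Run.after (isEmptyT S') fun e =>
      if 1 < i ∧ e = true then Run.fail
      else
        Run.after (nthT dv X 0) fun q =>
        Run.after (activeValuesT q S') fun vals =>
        forEach (decide (m < i)) (branch dv m X Xs i S' pre) vals := by
  rw [cPropagate]
  rfl

theorem cPropagate_outputs (dv : List ℕ) (m X : ℕ) (Xs : List ℕ) (i : ℕ) (S : List View)
    (pre : List ℕ) :
    (cPropagate dv m (X :: Xs) i S pre).outputs =
      if 1 < i ∧ ∃ v ∈ (gacT S).val, v.tuples = [] then [.failure]
      else (forEach (decide (m < i)) (branch dv m X Xs i (gacT S).val pre)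
        (activeValuesT (dv.getD X 0) (gacT S).val).val).outputs := by
  rw [cPropagate_cons, Run.after_outputs, Run.after_outputs]
  simp only [isEmptyT_val]
  split_ifs
  · simp [Run.fail, Run.outputs]
  · rw [Run.after_outputs, Run.after_outputs]
    rfl

theorem cPropagate_halted {dv : List ℕ} {m : ℕ} {Xs : List ℕ} {i : ℕ} {S : List View}
    {pre : List ℕ} (h : (cPropagate dv m Xs i S pre).halted = true) :
    Event.failure ∈ (cPropagate dv m Xs i S pre).outputs := by
  induction Xs generalizing i S pre with
  | nil => simp [cPropagate] at h
  | cons X Xs ih =>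
    rw [cPropagate_outputs]
    rw [cPropagate_cons, Run.after_halted, Run.after_halted] at h
    simp only [isEmptyT_val] at h
    split_ifs at h ⊢
    · simp
    · rw [Run.after_halted, Run.after_halted] at h
      refine forEach_halted (fun a ha => ?_) h
      by_cases hX : Xs = []
      · rw [branch, if_pos hX] at ha
        simp [Run.output] at ha
      · rw [branch_outputs hX]
        rw [branch, if_neg hX, Run.after_halted, Run.after_halted] at ha
        exact ih ha

theorem branch_halted {dv : List ℕ} {m X : ℕ} {Xs : List ℕ} {i : ℕ} {S : List View}
    {pre : List ℕ} {a : ℕ} (ha : (branch dv m X Xs i S pre a).halted = true) :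
    Event.failure ∈ (branch dv m X Xs i S pre a).outputs := by
  by_cases hX : Xs = []
  · rw [branch, if_pos hX] at ha
    simp [Run.output] at ha
  · rw [branch_outputs hX]
    rw [branch, if_neg hX, Run.after_halted, Run.after_halted] at ha
    exact cPropagate_halted ha

/-! ## The search for certified solutions -/

/-- What `cPropagate` needs to know about the views: `S₀` are the initial views, `Sol` is the set of
all homomorphisms, and the views with index in `base` (among them the domain views) guarantee a
homomorphism. -/
structure SearchSpace (dv vars : List ℕ) (S₀ : List View) (Sol : Set (ℕ → ℕ)) (base : Set ℕ) :
    Prop where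
  shaped : WellShaped S₀
  tuples_nodup : ∀ v ∈ S₀, v.tuples.Nodup
  vars_nodup : vars.Nodup
  dom : ∀ X ∈ vars, dv.getD X 0 ∈ base ∧ ∃ v, S₀[dv.getD X 0]? = some v ∧ v.scope = [X]
  base_scope : ∀ q ∈ base, ∀ v, S₀[q]? = some v → v.scope ≠ [] ∧ ∀ x ∈ v.scope, x ∈ vars
  sound : ∀ g : ℕ → ℕ, (∀ q ∈ base, ∀ v, S₀[q]? = some v → v.scope.map g ∈ v.tuples) → g ∈ Sol
  complete : ∀ g ∈ Sol, Contains S₀ g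

/-- The state of the search when `cPropagate` is called with the variables `todo` to be assigned,
after the values `pre` have been assigned to the variables `done`. -/
structure SearchState (dv vars : List ℕ) (S₀ : List View) (Sol : Set (ℕ → ℕ))
    (done todo : List ℕ) (S : List View) (pre : List ℕ) : Prop where
  vars_eq : vars = done ++ todo
  length_eq : done.length = pre.length
  sub : SubViews S S₀
  fixed : ∀ p ∈ done.zip pre, ∀ v, S[dv.getD p.1 0]? = some v → ∀ t ∈ v.tuples, t = [p.2]
  contains : ∀ g ∈ Sol, done.map g = pre → Contains S g

/-- Filtering only passes to sublists, so a domain view keeps its scope and remains a duplicate-free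
list of 1-tuples. This makes the loop values correspond exactly to its tuples. -/
theorem SearchSpace.dom_view {dv vars : List ℕ} {S₀ : List View} {Sol : Set (ℕ → ℕ)} {base : Set ℕ}
    (E : SearchSpace dv vars S₀ Sol base) {S : List View} (hS : SubViews S S₀) {X : ℕ}
    (hX : X ∈ vars) :
    ∃ v ∈ S, S[dv.getD X 0]? = some v ∧ v.scope = [X] ∧
      (activeValuesT (dv.getD X 0) S).val.Nodup ∧
      (∀ t ∈ v.tuples, ∃ a, t = [a]) ∧
      ∀ a, a ∈ (activeValuesT (dv.getD X 0) S).val ↔ [a] ∈ v.tuples := by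
  obtain ⟨-, v₀, hv₀, hs⟩ := E.dom X hX
  obtain ⟨v, hv, hsc, hsub⟩ := hS.getElem?' hv₀
  have ht : ∀ t ∈ v.tuples, ∃ a, t = [a] := by
    intro t ht
    have := E.shaped v₀ (List.mem_of_getElem? hv₀) t (hsub.subset ht)
    rw [hs] at this
    exact List.length_eq_one_iff.1 this
  have hnd : v.tuples.Nodup := hsub.nodup (E.tuples_nodup v₀ (List.mem_of_getElem? hv₀))
  have hact : (activeValuesT (dv.getD X 0) S).val = v.tuples.map fun t => t.getD 0 0 := by
    simp only [activeValuesT, timed_bind_val, mapT_val, nthT]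
    rw [List.getD_eq_getElem?_getD, hv]
    rfl
  refine ⟨v, List.mem_of_getElem? hv, hv, hsc.trans hs, ?_, ht, ?_⟩
  · rw [hact]
    refine List.Nodup.map_on ?_ hnd
    intro x hx y hy hxy
    obtain ⟨a, rfl⟩ := ht x hx
    obtain ⟨b, rfl⟩ := ht y hy
    simpa using hxy
  · intro a
    rw [hact, List.mem_map]
    constructor
    · rintro ⟨t, h, rfl⟩
      obtain ⟨b, rfl⟩ := ht t h
      simpa using h
    · intro h
      exact ⟨_, h, by simp⟩

section Search

variable {dv vars : List ℕ} {S₀ : List View} {Sol : Set (ℕ → ℕ)} {base : Set ℕ} {m : ℕ}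
  {done todo pre : List ℕ} {S : List View} {X a : ℕ}

theorem SearchState.gac_sub (h : SearchState dv vars S₀ Sol done todo S pre) :
    SubViews (gacT S).val S₀ := (gacT_subViews S).trans h.sub

theorem assignT_getElem? (q a k : ℕ) (S : List View) :
    (assignT q a S).val[k]? = if q = k then S[k]?.map fun v => ⟨v.scope, [[a]]⟩ else S[k]? := by
  change (S.modify q fun v => ⟨v.scope, [[a]]⟩)[k]? = _
  rw [List.getElem?_modify]
  split_ifs <;> simp_all

theorem assignT_subViews {q : ℕ} {v : View} (hq : S[q]? = some v) (ha : [a] ∈ v.tuples) :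
    SubViews (assignT q a S).val S := by
  change SubViews (S.modify q fun v => ⟨v.scope, [[a]]⟩) S
  unfold SubViews
  rw [List.forall₂_iff_get]
  refine ⟨by simp, fun i h₁ h₂ => ?_⟩
  simp only [List.get_eq_getElem, List.getElem_modify]
  split_ifs with h
  · subst h
    have : S[q] = v := by
      rw [List.getElem?_eq_getElem h₂] at hq
      simpa using hq
    rw [this]
    exact ⟨rfl, by simpa using ha⟩
  · exact ⟨rfl, List.Sublist.refl _⟩

theorem SearchState.next (E : SearchSpace dv vars S₀ Sol base)
    (h : SearchState dv vars S₀ Sol done (X :: todo) S pre)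
    (ha : a ∈ (activeValuesT (dv.getD X 0) (gacT S).val).val) :
    SearchState dv vars S₀ Sol (done ++ [X]) todo
      (assignT (dv.getD X 0) a (gacT S).val).val (pre ++ [a]) := by
  have hX : X ∈ vars := by rw [h.vars_eq]; simp
  obtain ⟨v, hvm, hv, hsc, -, -, hact⟩ := E.dom_view h.gac_sub hX
  have hsub := assignT_subViews hv ((hact a).1 ha)
  refine ⟨by simp [h.vars_eq], by simp [h.length_eq], hsub.trans h.gac_sub, ?_, ?_⟩
  · intro p hp w hw t ht
    rw [List.zip_append h.length_eq] at hp
    rw [assignT_getElem?] at hw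
    rcases List.mem_append.1 hp with hp | hp
    · have hY : p.1 ∈ done := (List.of_mem_zip hp).1
      obtain ⟨u, -, hu, husc, -⟩ := E.dom_view h.gac_sub (X := p.1) (by rw [h.vars_eq]; simp [hY])
      -- Different variables have different domain views, as the scopes differ; so assigning `X`
      -- leaves the views of the earlier variables alone.
      have hne : dv.getD X 0 ≠ dv.getD p.1 0 := by
        intro he
        rw [he, hu] at hv
        obtain rfl : u = v := by simpa using hv
        rw [hsc] at husc
        have hnd := E.vars_nodup
        rw [h.vars_eq] at hnd
        have hXp : X = p.1 := by simpa using husc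
        exact (List.nodup_append.1 hnd).2.2 p.1 hY X (by simp) hXp.symm
      rw [if_neg hne] at hw
      obtain ⟨w₀, hw₀, -, hws⟩ := (gacT_subViews S).getElem? hw
      exact h.fixed p hp w₀ hw₀ t (hws.subset ht)
    · obtain rfl : p = (X, a) := by simpa using hp
      rw [if_pos rfl, hv] at hw
      obtain rfl : _ = w := by simpa using hw
      simpa using ht
  · intro g hg hgp
    rw [List.map_append] at hgp
    have hlen : (done.map g).length = pre.length := by simp [h.length_eq]
    obtain ⟨h1, h2⟩ := List.append_inj hgp hlen
    have h2 : g X = a := by simpa using h2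
    have hc := (h.contains g hg h1).gacT
    intro w hw
    obtain ⟨k, hk⟩ := List.mem_iff_getElem?.1 hw
    rw [assignT_getElem?] at hk
    by_cases hkq : dv.getD X 0 = k
    · rw [if_pos hkq, ← hkq, hv] at hk
      obtain rfl : _ = w := by simpa using hk
      simp [hsc, h2]
    · rw [if_neg hkq] at hk
      exact hc w (List.mem_of_getElem? hk)

/-- Once all variables are assigned, arc consistency of the views gives a homomorphism. -/
theorem SearchState.exists_solution (E : SearchSpace dv vars S₀ Sol base)
    (h : SearchState dv vars S₀ Sol done [X] S pre)
    (hne : done = [] ∨ ∀ v ∈ (gacT S).val, v.tuples ≠ [])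
    (ha : a ∈ (activeValuesT (dv.getD X 0) (gacT S).val).val) :
    ∃ g ∈ Sol, vars.map g = pre ++ [a] := by
  have hac := gacT_arcConsistent S
  have hws := E.shaped.subViews h.gac_sub
  have hX : X ∈ vars := by rw [h.vars_eq]; simp
  obtain ⟨v, hvm, hv, hsc, -, -, hact⟩ := E.dom_view h.gac_sub hX
  have hva := (hact a).1 ha
  have hnd := E.vars_nodup
  have hl : vars.length = (pre ++ [a]).length := by simp [h.vars_eq, h.length_eq]
  let g : ℕ → ℕ := fun x => (pre ++ [a]).getD (vars.idxOf x) 0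
  have hg : vars.map g = pre ++ [a] := by
    refine List.ext_getElem (by simpa using hl) fun i h1 h2 => ?_
    have hi : i < vars.length := by simpa using h1
    simp only [List.getElem_map, g, hnd.idxOf_getElem i hi]
    exact List.getD_eq_getElem _ _ h2
  have hgs : done.map g = pre ∧ g X = a := by
    have := hg
    rw [h.vars_eq, List.map_append] at this
    obtain ⟨h1, h2⟩ := List.append_inj this (by simp [h.length_eq])
    exact ⟨h1, by simpa using h2⟩
  refine ⟨g, E.sound g fun q hq v₀ hv₀ => ?_, hg⟩
  obtain ⟨u, hu, husc, husub⟩ := h.gac_sub.getElem?' hv₀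
  have hum := List.mem_of_getElem? hu
  obtain ⟨hscne, hscv⟩ := E.base_scope q hq v₀ hv₀
  refine husub.subset ?_
  rw [← husc] at hscne hscv ⊢
  -- The last value is not propagated any further. Instead the tuple of the base view is chosen as a
  -- support of `a` when `X` occurs in its scope, and arbitrarily otherwise.
  have hb : ∃ g' : ℕ → ℕ, u.scope.map g' ∈ u.tuples ∧ (X ∈ u.scope → g' X = a) := by
    by_cases hXu : X ∈ u.scope
    · obtain ⟨g', hg', he⟩ := hac.exists_support hws hvm hum (g := fun _ => a)
        (by simpa [hsc] using hva) ⟨X, by simp [hsc], hXu⟩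
      exact ⟨g', hg', fun _ => (he X (by simp [hsc]) hXu).symm⟩
    -- If `X` were the only variable, the non-empty scope would contain it. So this is not the first
    -- call, and the views are known to be non-empty.
    · have hdone : done ≠ [] := by
        rintro rfl
        obtain ⟨x, hx⟩ := List.exists_mem_of_ne_nil _ hscne
        have := hscv x hx
        rw [h.vars_eq] at this
        obtain rfl : x = X := by simpa using this
        exact hXu hx
      obtain ⟨b, hb⟩ := List.exists_mem_of_ne_nil _ ((hne.resolve_left hdone) u hum)
      obtain ⟨g', rfl⟩ := hac.exists_map_eq hws hum hb
      exact ⟨g', hb, fun h => absurd h hXu⟩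
  obtain ⟨g', hg', hgX⟩ := hb
  -- On an earlier variable the chosen tuple is supported in a domain view whose only possible value
  -- is the assigned one.
  have : u.scope.map g = u.scope.map g' := by
    refine List.map_congr_left fun x hx => ?_
    have hxv := hscv x hx
    rw [h.vars_eq, List.mem_append] at hxv
    rcases hxv with hxd | hxX
    · obtain ⟨w, hwm, hw, hwsc, -, hw1, -⟩ := E.dom_view h.gac_sub (X := x)
        (by rw [h.vars_eq]; simp [hxd])
      obtain ⟨g₂, hg₂, he⟩ := hac.exists_support hws hum hwm hg' ⟨x, hx, by simp [hwsc]⟩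
      rw [he x hx (by simp [hwsc])]
      have hp : (x, g x) ∈ done.zip pre := by
        rw [← hgs.1]
        obtain ⟨k, hk, rfl⟩ := List.mem_iff_getElem.1 hxd
        exact List.mem_iff_getElem.2 ⟨k, by simpa using hk, by simp⟩
      obtain ⟨w₀, hw₀, -, hwsub⟩ := (gacT_subViews S).getElem? hw
      have := h.fixed _ hp w₀ hw₀ _ (hwsub.subset hg₂)
      rw [hwsc] at this
      simpa [eq_comm] using this
    · obtain rfl : x = X := by simpa using hxX
      rw [hgs.2, hgX hx]
  rw [this]
  exact hg'

/-- A run outputs only homomorphisms that extend the values assigned so far. -/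
def SoundRun (vars : List ℕ) (Sol : Set (ℕ → ℕ)) (m : ℕ) (done pre : List ℕ) (R : Run) : Prop :=
  ∀ h c, Event.solution h c ∈ R.outputs →
    ∃ g ∈ Sol, done.map g = pre ∧ h = (vars.map g).take m ∧ c = (vars.map g).drop m

/-- Soundness of the deeper calls is a hypothesis, so that the lemma serves both inside the
induction for `SearchState.soundRun` and, once that is proved, in the proof that there are no
repetitions. -/
theorem SoundRun.branch (E : SearchSpace dv vars S₀ Sol base)
    (h : SearchState dv vars S₀ Sol done (X :: todo) S pre)
    (hne : ¬ (1 < done.length + 1 ∧ ∃ v ∈ (gacT S).val, v.tuples = []))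
    (ha : a ∈ (activeValuesT (dv.getD X 0) (gacT S).val).val)
    (ih : ∀ (done : List ℕ) (S : List View) (pre : List ℕ),
      SearchState dv vars S₀ Sol done todo S pre →
        SoundRun vars Sol m done pre (cPropagate dv m todo (done.length + 1) S pre)) :
    SoundRun vars Sol m (done ++ [X]) (pre ++ [a])
      (branch dv m X todo (done.length + 1) (gacT S).val pre a) := by
  intro h' c hm
  by_cases ht : todo = []
  · subst ht
    rw [branch_nil, Run.output_outputs] at hm
    have hm : h' = (pre ++ [a]).take m ∧ c = (pre ++ [a]).drop m := by simpa using hm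
    obtain ⟨rfl, rfl⟩ := hm
    obtain ⟨g, hg, hgv⟩ := h.exists_solution E (by
      by_cases hd : done = []
      · exact Or.inl hd
      · have := List.length_pos_iff.2 hd
        exact Or.inr fun v hv hv' => hne ⟨by omega, v, hv, hv'⟩) ha
    exact ⟨g, hg, by rw [← h.vars_eq, hgv], by rw [hgv], by rw [hgv]⟩
  · rw [branch_outputs ht] at hm
    have := ih _ _ _ (h.next E ha) h' c
    rw [List.length_append, List.length_singleton] at this
    exact this hm

theorem SearchState.soundRun (E : SearchSpace dv vars S₀ Sol base)
    (h : SearchState dv vars S₀ Sol done todo S pre) :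
    SoundRun vars Sol m done pre (cPropagate dv m todo (done.length + 1) S pre) := by
  induction todo generalizing done S pre with
  | nil => intro h' c hm; simp [cPropagate, Run.outputs] at hm
  | cons X todo ih =>
    intro h' c hm
    rw [cPropagate_outputs] at hm
    split_ifs at hm with hne
    · simp at hm
    · obtain ⟨a, ha, hm'⟩ := forEach_outputs_subset hm
      obtain ⟨g, hg, h1, h2⟩ := SoundRun.branch E h hne ha (fun _ _ _ hs => ih hs) h' c hm'
      rw [List.map_append] at h1
      exact ⟨g, hg, (List.append_inj h1 (by simp [h.length_eq])).1, h2⟩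

theorem SearchState.projected_nodup (E : SearchSpace dv vars S₀ Sol base)
    (h : SearchState dv vars S₀ Sol done todo S pre) :
    (cPropagate dv m todo (done.length + 1) S pre).projected.Nodup := by
  induction todo generalizing done S pre with
  | nil => simp [cPropagate, Run.projected, Run.outputs]
  | cons X todo ih =>
    rw [Run.projected, cPropagate_outputs]
    split_ifs with hne
    · simp
    · obtain ⟨-, -, -, -, hnd, -, -⟩ := E.dom_view h.gac_sub (X := X) (by rw [h.vars_eq]; simp)
      refine forEach_projected_nodup hnd (fun a ha => ?_) (fun hbrk a ha b hb h' hh hh' => ?_)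
      · by_cases ht : todo = []
        · subst ht
          rw [branch_nil, Run.projected, Run.output_outputs]
          simp
        · rw [Run.projected, branch_outputs ht]
          have := ih (h.next E ha)
          rw [List.length_append, List.length_singleton] at this
          exact this
      · have hlt : done.length < m := by
          have := of_decide_eq_false hbrk
          omega
        -- On the first `m` levels the value chosen here is the entry of the projected solution at
        -- position `done.length`, so it can be recovered from the output.
        have key : ∀ a ∈ (activeValuesT (dv.getD X 0) (gacT S).val).val,
            h' ∈ (branch dv m X todo (done.length + 1) (gacT S).val pre a).projected →
              h'[done.length]? = some a := by
          intro a ha hh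
          obtain ⟨c, hc⟩ := Run.mem_projected.1 hh
          obtain ⟨g, -, h1, rfl, -⟩ :=
            SoundRun.branch E h hne ha (fun _ _ _ hs => hs.soundRun E) h' c hc
          rw [List.map_append] at h1
          have h2 := (List.append_inj h1 (by simp [h.length_eq])).2
          rw [List.getElem?_take_of_lt hlt, h.vars_eq, List.map_append,
            List.getElem?_append_right (by simp)]
          simpa using h2
        have h1 := key a ha hh
        rw [key b hb hh'] at h1
        simpa using h1.symm

/-- Only the first `m` values are compared with `g`: up to there the search can follow `g`, and
afterwards it takes the first value at each level, which may leave `g` without affecting the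
projected solution. -/
theorem SearchState.mem_projected (E : SearchSpace dv vars S₀ Sol base)
    (h : SearchState dv vars S₀ Sol done todo S pre) (ht : todo ≠ [])
    (hf : Event.failure ∉ (cPropagate dv m todo (done.length + 1) S pre).outputs)
    {g : ℕ → ℕ} (hg : g ∈ Sol) (hgp : (done.map g).take m = pre.take m) :
    (vars.map g).take m ∈ (cPropagate dv m todo (done.length + 1) S pre).projected := by
  induction todo generalizing done S pre with
  | nil => exact absurd rfl ht
  | cons X todo ih =>
    rw [cPropagate_outputs] at hf
    rw [Run.mem_projected, cPropagate_outputs]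
    split_ifs at hf ⊢ with hne
    · simp at hf
    obtain ⟨v, hvm, hv, hsc, -, hone, hact⟩ :=
      E.dom_view h.gac_sub (X := X) (by rw [h.vars_eq]; simp)
    have hin : done.map g = pre → g X ∈ (activeValuesT (dv.getD X 0) (gacT S).val).val := by
      intro hd
      have := (h.contains g hg hd).gacT v hvm
      rw [hsc] at this
      exact (hact _).2 (by simpa using this)
    have hbr : ∀ a ∈ (activeValuesT (dv.getD X 0) (gacT S).val).val,
        Event.failure ∉ (branch dv m X todo (done.length + 1) (gacT S).val pre a).outputs →
        ((done ++ [X]).map g).take m = (pre ++ [a]).take m →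
        ∃ c, Event.solution ((vars.map g).take m) c ∈
          (branch dv m X todo (done.length + 1) (gacT S).val pre a).outputs := by
      intro a ha hfa he
      by_cases ht' : todo = []
      · subst ht'
        rw [branch_nil, Run.output_outputs, h.vars_eq, he]
        exact ⟨_, List.mem_singleton.2 rfl⟩
      · rw [branch_outputs ht'] at hfa ⊢
        have := ih (h.next E ha) ht'
        rw [List.length_append, List.length_singleton] at this
        exact Run.mem_projected.1 (this hfa he)
    by_cases hm : done.length < m
    · have hd : done.map g = pre := by
        rwa [List.take_of_length_le (by simp; omega),
          List.take_of_length_le (by have := h.length_eq; omega)] at hgp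
      have hbrk : decide (m < done.length + 1) = false := decide_eq_false (by omega)
      rw [hbrk] at hf ⊢
      have hfa : Event.failure ∉
          (branch dv m X todo (done.length + 1) (gacT S).val pre (g X)).outputs := fun hh =>
        hf (mem_forEach_outputs (fun _ => branch_halted) hf (hin hd) hh)
      obtain ⟨c, hc⟩ := hbr (g X) (hin hd) hfa (by simp [hd])
      exact ⟨c, mem_forEach_outputs (fun _ => branch_halted) hf (hin hd) hc⟩
    · have hbrk : decide (m < done.length + 1) = true := decide_eq_true (by omega)
      rw [hbrk] at hf ⊢
      -- In the first call emptiness is not tested, and the value of `g` survives the filtering; in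
      -- later calls the test guarantees a value.
      have hex : (activeValuesT (dv.getD X 0) (gacT S).val).val ≠ [] := by
        by_cases hdn : done = []
        · subst hdn
          have hpre : pre = [] := by simpa using h.length_eq.symm
          subst hpre
          exact List.ne_nil_of_mem (hin rfl)
        · have := List.length_pos_iff.2 hdn
          have hvt : v.tuples ≠ [] := fun hv' => hne ⟨by omega, v, hvm, hv'⟩
          obtain ⟨t, ht1⟩ := List.exists_mem_of_ne_nil _ hvt
          obtain ⟨b, rfl⟩ := hone t ht1
          exact List.ne_nil_of_mem ((hact b).2 ht1)
      generalize hl : (activeValuesT (dv.getD X 0) (gacT S).val).val = l at hf hex hbr ⊢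
      cases l with
      | nil => exact absurd rfl hex
      | cons a l =>
        rw [forEach_outputs_cons, if_pos (by simp)] at hf ⊢
        refine hbr a (by simp) hf ?_
        rw [List.map_append, List.take_append_of_le_length (by simp; omega),
          List.take_append_of_le_length (by have := h.length_eq; omega), hgp]

/-- In arc consistent views, every value of a variable extends to a homomorphism whose values all
occur in the domain views. -/
def Extendable (dv vars : List ℕ) (S₀ : List View) (Sol : Set (ℕ → ℕ)) : Prop :=
  ∀ S, SubViews S S₀ → ArcConsistent S → ∀ X ∈ vars, ∀ v, S[dv.getD X 0]? = some v →
    ∀ a, [a] ∈ v.tuples → ∃ g ∈ Sol, g X = a ∧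
      ∀ Y ∈ vars, ∀ w, S[dv.getD Y 0]? = some w → [g Y] ∈ w.tuples

/-- The invariant is that the values assigned so far extend to a homomorphism, whose restrictions
keep every view non-empty after filtering. The first call needs no invariant, since it does not test
for emptiness. -/
theorem SearchState.no_failure (E : SearchSpace dv vars S₀ Sol base)
    (hext : Extendable dv vars S₀ Sol)
    (h : SearchState dv vars S₀ Sol done todo S pre)
    (hd : done = [] ∨ ∃ g ∈ Sol, done.map g = pre) :
    Event.failure ∉ (cPropagate dv m todo (done.length + 1) S pre).outputs := by
  induction todo generalizing done S pre with
  | nil => simp [cPropagate, Run.outputs]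
  | cons X todo ih =>
    rw [cPropagate_outputs]
    split_ifs with hne
    · rcases hd with rfl | ⟨g, hg, hgp⟩
      · simp at hne
      · obtain ⟨-, v, hv, hv'⟩ := hne
        have := (h.contains g hg hgp).gacT v hv
        simp [hv'] at this
    · intro hf
      obtain ⟨a, ha, hf⟩ := forEach_outputs_subset hf
      by_cases ht : todo = []
      · subst ht
        rw [branch_nil, Run.output_outputs] at hf
        simp at hf
      · rw [branch_outputs ht] at hf
        have := ih (h.next E ha)
        rw [List.length_append, List.length_singleton] at this
        refine this (Or.inr ?_) hf
        have hX : X ∈ vars := by rw [h.vars_eq]; simp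
        obtain ⟨v, hvm, hv, hsc, -, hone, hact⟩ := E.dom_view h.gac_sub hX
        obtain ⟨g, hg, hgX, hgY⟩ :=
          hext _ h.gac_sub (gacT_arcConsistent S) X hX v hv a ((hact a).1 ha)
        refine ⟨g, hg, ?_⟩
        rw [List.map_append]
        congr 1
        -- The new homomorphism takes its values in the domain views, and those of earlier variables
        -- allow only the assigned values.
        · refine List.ext_getElem (by simp [h.length_eq]) fun i h1 h2 => ?_
          have hi : i < done.length := by simpa using h1
          have hmem : done[i] ∈ vars := by rw [h.vars_eq]; simp
          obtain ⟨w, -, hw, -⟩ := E.dom_view h.gac_sub hmem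
          obtain ⟨w₀, hw₀, -, hws⟩ := (gacT_subViews S).getElem? hw
          have := h.fixed (done[i], pre[i]) (List.mem_iff_getElem.2 ⟨i, by simp; omega, by simp⟩)
            w₀ hw₀ _ (hws.subset (hgY _ hmem w hw))
          simpa using this
        · simp [hgX]

theorem no_failure_singleton (dv : List ℕ) (m X : ℕ) (S : List View) (pre : List ℕ) :
    Event.failure ∉ (cPropagate dv m [X] 1 S pre).outputs := by
  rw [cPropagate_outputs, if_neg (by simp)]
  intro hf
  obtain ⟨a, -, hf⟩ := forEach_outputs_subset hf
  rw [branch_nil, Run.output_outputs] at hf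
  simp at hf

end Search

/-! ## The views of a decomposition method as a search space -/

theorem arity_eq_of_getElem? {A B : RelStructure} (h : A.vocabulary = B.vocabulary) {q : ℕ}
    {a b : RelTable} (ha : A.rels[q]? = some a) (hb : B.rels[q]? = some b) : a.arity = b.arity := by
  have := congrArg (fun l => l[q]?) h
  simpa [RelStructure.vocabulary, ha, hb] using this

theorem exists_getElem?_of_vocabulary {A B : RelStructure} (h : A.vocabulary = B.vocabulary) {q : ℕ}
    {a : RelTable} (ha : A.rels[q]? = some a) : ∃ b, B.rels[q]? = some b := by
  have hl := congrArg List.length h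
  simp only [RelStructure.vocabulary, List.length_map] at hl
  have := (List.getElem?_eq_some_iff.1 ha).1
  exact ⟨_, List.getElem?_eq_getElem (by omega)⟩

theorem mem_zip_iff_getElem? {α β : Type} {l : List α} {l' : List β} {p : α × β} :
    p ∈ l.zip l' ↔ ∃ q : ℕ, l[q]? = some p.1 ∧ l'[q]? = some p.2 := by
  rw [List.mem_iff_getElem?]
  refine exists_congr fun q => ?_
  rw [List.getElem?_zip_eq_some]

theorem initViewsT_val (V : ViewStructure) (BV : RelStructure) :
    (initViewsT V BV).val =
      (V.str.rels.zip BV.rels).map fun p => ⟨p.1.scope, p.2.tuples⟩ := by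
  simp [initViewsT, timed_bind_val, mapT_val, zipT]

theorem initViewsT_getElem? {V : ViewStructure} {BV : RelStructure} {q : ℕ} {v : View} :
    (initViewsT V BV).val[q]? = some v ↔
      ∃ a b, V.str.rels[q]? = some a ∧ BV.rels[q]? = some b ∧ v = ⟨a.scope, b.tuples⟩ := by
  rw [initViewsT_val, List.getElem?_map]
  constructor
  · intro h
    obtain ⟨p, hp, rfl⟩ := Option.map_eq_some_iff.1 h
    obtain ⟨h1, h2⟩ := List.getElem?_zip_eq_some.1 hp
    exact ⟨_, _, h1, h2, rfl⟩
  · rintro ⟨a, b, ha, hb, rfl⟩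
    have := (List.getElem?_zip_eq_some (z := (a, b))).2 ⟨ha, hb⟩
    rw [this]
    rfl

/-- The relation symbols `doms` are interpreted by the single variables. -/
def DomainSymbols (A : RelStructure) (doms : List ℕ) : Prop :=
  doms.length = A.card ∧
    ∀ X < A.card, ∃ r, A.rels[doms.getD X 0]? = some r ∧ r.tuples = [[X]]

theorem domViewsT_getD {A : RelStructure} {V : ViewStructure} {doms : List ℕ}
    (hd : DomainSymbols A doms) {X q : ℕ} (hX : X < A.card)
    (hq : V.baseView (doms.getD X 0) 0 = some q) :
    (domViewsT V doms).val.getD X 0 = q := by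
  have hX' : X < doms.length := by rw [hd.1]; exact hX
  simp only [domViewsT, mapT_val, timed_bind_val, nthT]
  rw [List.getD_eq_getElem _ _ (by simpa using hX'), List.getElem_map]
  rw [List.getD_eq_getElem _ _ hX'] at hq
  simp only [ViewStructure.baseView, Option.bind_eq_some_iff] at hq
  obtain ⟨row, h1, h2⟩ := hq
  simp [List.getD_eq_getElem?_getD, h1, h2]

/-- The indices of the base views. -/
def baseIndices (A : RelStructure) (V : ViewStructure) : Set ℕ :=
  {q | ∃ i j r t, A.rels[i]? = some r ∧ r.tuples[j]? = some t ∧ V.baseView i j = some q}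

section Legal

variable {I : CSPInstance} {V : ViewStructure} {BV : RelStructure} {doms vars : List ℕ}

theorem IsViewStructure.exists_view (hV : IsViewStructure I.lhs V) (hL : IsLegal I V BV)
    {i j : ℕ} {r : RelTable} {t : List ℕ} (hr : I.lhs.rels[i]? = some r)
    (ht : r.tuples[j]? = some t) :
    ∃ q ∈ baseIndices I.lhs V, V.baseView i j = some q ∧
      ∃ v, (initViewsT V BV).val[q]? = some v ∧ v.scope = t := by
  obtain ⟨q, v, hq, hv, hvt⟩ := hV.base i j r t hr ht
  obtain ⟨b, hb⟩ := exists_getElem?_of_vocabulary hL.vocabulary_eq.symm hv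
  exact ⟨q, ⟨i, j, r, t, hr, ht, hq⟩, hq, _, initViewsT_getElem?.2 ⟨v, b, hv, hb, rfl⟩,
    by simp [RelTable.scope, hvt]⟩

theorem IsViewStructure.scope_eq (hV : IsViewStructure I.lhs V)
    {i j q : ℕ} {r : RelTable} {t : List ℕ} (hr : I.lhs.rels[i]? = some r)
    (ht : r.tuples[j]? = some t) (hq : V.baseView i j = some q) {v : View}
    (hv : (initViewsT V BV).val[q]? = some v) : v.scope = t := by
  obtain ⟨a, b, ha, -, rfl⟩ := initViewsT_getElem?.1 hv
  obtain ⟨q', v', hq', hv', hvt⟩ := hV.base i j r t hr ht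
  rw [hq] at hq'
  obtain rfl : q = q' := by simpa using hq'
  rw [ha] at hv'
  obtain rfl : a = v' := by simpa using hv'
  simp [RelTable.scope, hvt]

theorem scope_mem_tuples {r : RelTable} (h : r.tuples.length = 1) : r.tuples = [r.scope] := by
  obtain ⟨t, ht⟩ := List.length_eq_one_iff.1 h
  simp [RelTable.scope, ht]

theorem searchSpace (hV : IsViewStructure I.lhs V) (hL : IsLegal I V BV)
    (hd : DomainSymbols I.lhs doms) (hne : ∀ e ∈ I.lhs.hypergraph.edgeSet, e.Nonempty)
    (hnd : vars.Nodup) (hvars : ∀ x, x ∈ vars ↔ x < I.lhs.card) :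
    SearchSpace (domViewsT V doms).val vars (initViewsT V BV).val {g | IsHom I.lhs I.rhs g}
      (baseIndices I.lhs V) := by
  refine ⟨?_, ?_, hnd, ?_, ?_, ?_, ?_⟩
  · intro v hv b hb
    obtain ⟨q, hq⟩ := List.mem_iff_getElem?.1 hv
    obtain ⟨a, c, ha, hc, rfl⟩ := initViewsT_getElem?.1 hq
    have ham := List.mem_of_getElem? ha
    have hs := scope_mem_tuples (hV.single a ham)
    have h1 := ((V.str.wf a ham).2 a.scope (by rw [hs]; simp)).1
    have h2 := ((BV.wf c (List.mem_of_getElem? hc)).2 b hb).1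
    simp only
    rw [h1, h2, arity_eq_of_getElem? hL.vocabulary_eq hc ha]
  · intro v hv
    obtain ⟨q, hq⟩ := List.mem_iff_getElem?.1 hv
    obtain ⟨a, c, -, hc, rfl⟩ := initViewsT_getElem?.1 hq
    exact (BV.wf c (List.mem_of_getElem? hc)).1
  · intro X hX
    rw [hvars] at hX
    obtain ⟨r, hr, hrt⟩ := hd.2 X hX
    obtain ⟨q, hqb, hq, v, hv, hvs⟩ := hV.exists_view hL hr (j := 0) (t := [X]) (by simp [hrt])
    rw [domViewsT_getD hd hX hq]
    exact ⟨hqb, v, hv, hvs⟩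
  · rintro q ⟨i, j, r, t, hr, ht, hq⟩ v hv
    have hrm := List.mem_of_getElem? hr
    have htm := List.mem_of_getElem? ht
    rw [hV.scope_eq hr ht hq hv]
    refine ⟨?_, fun x hx => (hvars x).2 (((I.lhs.wf r hrm).2 t htm).2 x hx)⟩
    rintro rfl
    obtain ⟨x, hx⟩ := hne {x | x ∈ ([] : List ℕ)} ⟨r, hrm, _, htm, rfl⟩
    simp at hx
  · intro g hg
    have key : ∀ (i j : ℕ) (a b : RelTable) (t : List ℕ), I.lhs.rels[i]? = some a →
        I.rhs.rels[i]? = some b → a.tuples[j]? = some t → t.map g ∈ b.tuples := by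
      intro i j a b t ha hb ht
      obtain ⟨q, hqb, hq, v, hv, rfl⟩ := hV.exists_view hL ha ht
      obtain ⟨c, w, hc, hw, rfl⟩ := initViewsT_getElem?.1 hv
      exact hL.base i j q a b w ha hb (List.getElem?_eq_some_iff.1 ht).1 hq hw _ (hg q hqb _ hv)
    constructor
    -- A homomorphism must also map into the universe of `B`; the domain constraint on `X` forces
    -- this.
    · intro X hX
      obtain ⟨r, hr, hrt⟩ := hd.2 X hX
      obtain ⟨b, hb⟩ := exists_getElem?_of_vocabulary I.same_vocabulary hr
      have := key _ 0 r b [X] hr hb (by simp [hrt])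
      exact ((I.rhs.wf b (List.mem_of_getElem? hb)).2 _ this).2 _ (by simp)
    · intro p hp t ht
      obtain ⟨i, h1, h2⟩ := mem_zip_iff_getElem?.1 hp
      obtain ⟨j, hj⟩ := List.mem_iff_getElem?.1 ht
      exact key i j _ _ t h1 h2 hj
  · intro g hg v hv
    obtain ⟨q, hq⟩ := List.mem_iff_getElem?.1 hv
    obtain ⟨a, c, ha, hc, rfl⟩ := initViewsT_getElem?.1 hq
    exact hL.complete (a, c) (mem_zip_iff_getElem?.2 ⟨q, ha, hc⟩) _ ⟨g, hg, rfl⟩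

/-- If there is a tree projection, then arc consistent views have no dead ends. -/
theorem extendable_of_hasTreeProjection (hV : IsViewStructure I.lhs V) (hL : IsLegal I V BV)
    (hd : DomainSymbols I.lhs doms) (hconn : IsConnected I.lhs.hypergraph)
    (hnd : vars.Nodup) (hvars : ∀ x, x ∈ vars ↔ x < I.lhs.card)
    (htp : HasTreeProjection I.lhs.hypergraph V.str.hypergraph) :
    Extendable (domViewsT V doms).val vars (initViewsT V BV).val {g | IsHom I.lhs I.rhs g} := by
  classical
  have E := searchSpace hV hL hd hconn.2.1 hnd hvars
  intro S hS hac X hX v hv a hva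
  have hws := E.shaped.subViews hS
  have hvm := List.mem_of_getElem? hv
  have hscX : v.scope = [X] := by
    obtain ⟨w, -, hw, hws, -⟩ := E.dom_view hS hX
    rw [hv] at hw
    obtain rfl : v = w := by simpa using hw
    exact hws
  -- the view with a given tuple of variables
  have hbase : ∀ e ∈ I.lhs.hypergraph.edgeSet, ∃ u ∈ S, ∀ x, x ∈ u.scope ↔ x ∈ e := by
    rintro e ⟨r, hr, t, ht, rfl⟩
    obtain ⟨i, hi⟩ := List.mem_iff_getElem?.1 hr
    obtain ⟨j, hj⟩ := List.mem_iff_getElem?.1 ht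
    obtain ⟨q, -, -, v₀, hv₀, rfl⟩ := hV.exists_view hL hi hj
    obtain ⟨u, hu, hus, -⟩ := hS.getElem?' hv₀
    exact ⟨u, List.mem_of_getElem? hu, fun x => by rw [hus]; rfl⟩
  -- Non-emptiness spreads from `X` along the hyperedges of `A`: from a domain view to the base view
  -- of a hyperedge, and from there to the domain view of another of its variables.
  have hdomne : ∀ Y, Relation.ReflTransGen I.lhs.hypergraph.Adj X Y → Y ∈ vars →
      ∃ w ∈ S, w.scope = [Y] ∧ ∃ b : ℕ, [b] ∈ w.tuples := by
    intro Y hXY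
    induction hXY with
    | refl => exact fun _ => ⟨v, hvm, hscX, a, hva⟩
    | @tail y z _ hyz ih =>
      intro hz
      obtain ⟨e, he, hye, hze⟩ := hyz
      have hy : y ∈ vars := (hvars y).2 (I.lhs.hypergraph.subset_vertexSet_of_mem_edgeSet' he hye)
      obtain ⟨w, hw, hws', b, hb⟩ := ih hy
      obtain ⟨u, hu, hus⟩ := hbase e he
      obtain ⟨g, hg, -⟩ := hac.exists_support hws hw hu (g := fun _ => b) (by simpa [hws'] using hb)
        ⟨y, by simp [hws'], (hus y).2 hye⟩
      obtain ⟨w', hw', -, hws'', -⟩ := E.dom_view hS hz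
      obtain ⟨g', hg', -⟩ := hac.exists_support hws hu hw' hg ⟨z, (hus z).2 hze, by simp [hws'']⟩
      exact ⟨w', hw', hws'', g' z, by simpa [hws''] using hg'⟩
  have hscope : ∀ w ∈ S, ∀ Y ∈ w.scope, Y ∈ vars := by
    intro w hw Y hY
    obtain ⟨w₀, hw₀, hs, -⟩ := hS.exists_of_mem hw
    obtain ⟨q, hq⟩ := List.mem_iff_getElem?.1 hw₀
    obtain ⟨c, b, hc, -, rfl⟩ := initViewsT_getElem?.1 hq
    have hcm := List.mem_of_getElem? hc
    rw [hvars, ← hV.card_eq]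
    rw [hs] at hY
    exact ((V.str.wf c hcm).2 c.scope (by rw [scope_mem_tuples (hV.single c hcm)]; simp)).2 Y hY
  have hviewne : ∀ w ∈ S, ∀ Y ∈ w.scope, ∃ g : ℕ → ℕ, w.scope.map g ∈ w.tuples := by
    intro w hw Y hY
    have hYv := hscope w hw Y hY
    obtain ⟨u, hu, hus, b, hb⟩ := hdomne Y
      (hconn.2.2 X ((hvars X).1 hX) Y ((hvars Y).1 hYv)) hYv
    obtain ⟨g, hg, -⟩ := hac.exists_support hws hu hw (g := fun _ => b) (by simpa [hus] using hb)
      ⟨Y, by simp [hus], hY⟩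
    exact ⟨g, hg⟩
  obtain ⟨Ha, ⟨T, hT, hTac, hjt⟩, hc₁, hc₂⟩ := htp
  have hcover : ∀ e : Ha.edgeSet, ∃ u ∈ S, ∀ x ∈ e.1, x ∈ u.scope := by
    intro e
    obtain ⟨f, ⟨r, hr, t, ht, rfl⟩, hef⟩ := hc₂ e.1 e.2
    obtain ⟨q, hq⟩ := List.mem_iff_getElem?.1 hr
    obtain ⟨b, hb⟩ := exists_getElem?_of_vocabulary hL.vocabulary_eq.symm hq
    obtain ⟨u, hu, hus, -⟩ := hS.getElem?' (initViewsT_getElem?.2 ⟨r, b, hq, hb, rfl⟩)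
    refine ⟨u, List.mem_of_getElem? hu, fun x hx => ?_⟩
    have hxt : x ∈ t := hef hx
    rw [scope_mem_tuples (hV.single r hr)] at ht
    rw [hus]
    obtain rfl : t = r.scope := by simpa using ht
    exact hxt
  -- The choice at a hyperedge is the trace of a tuple of some covering view. Empty hyperedges are
  -- exempt: they may be covered only by a view without variables, which can be empty.
  let P : Ha.edgeSet → (ℕ → ℕ) → Prop := fun e g => (∃ x, x ∈ e.1) →
    ∃ u ∈ S, (∀ x ∈ e.1, x ∈ u.scope) ∧ ∃ g₁ : ℕ → ℕ, u.scope.map g₁ ∈ u.tuples ∧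
      ∀ x ∈ e.1, g₁ x = g x
  have hstep : ∀ e f g, P e g → ∃ g', P f g' ∧ ∀ x, x ∈ e.1 → x ∈ f.1 → g x = g' x := by
    intro e f g hP
    -- If the hyperedges meet, so do the covering views, and arc consistency transfers the tuple.
    -- Otherwise there is nothing to match and any tuple will do.
    by_cases hef : ∃ x, x ∈ e.1 ∧ x ∈ f.1
    · obtain ⟨x, hxe, hxf⟩ := hef
      obtain ⟨u, hu, hus, g₁, hg₁, he⟩ := hP ⟨x, hxe⟩
      obtain ⟨w, hw, hws'⟩ := hcover f
      obtain ⟨g', hg', hgg⟩ := hac.exists_support hws hu hw hg₁ ⟨x, hus x hxe, hws' x hxf⟩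
      exact ⟨g', fun _ => ⟨w, hw, hws', g', hg', fun _ _ => rfl⟩,
        fun y hye hyf => by rw [← he y hye, hgg y (hus y hye) (hws' y hyf)]⟩
    · by_cases hf : ∃ x, x ∈ f.1
      · obtain ⟨x, hxf⟩ := hf
        obtain ⟨w, hw, hws'⟩ := hcover f
        obtain ⟨g', hg'⟩ := hviewne w hw x (hws' x hxf)
        exact ⟨g', fun _ => ⟨w, hw, hws', g', hg', fun _ _ => rfl⟩,
          fun y hye hyf => absurd ⟨y, hye, hyf⟩ hef⟩
      · exact ⟨g, fun h => absurd h hf, fun _ _ _ => rfl⟩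
  -- The root of the join tree is a hyperedge containing `X`. It exists because the instance is
  -- domain restricted, so that `{X}` is a hyperedge to be covered.
  obtain ⟨rX, hrX, hrXt⟩ := hd.2 X ((hvars X).1 hX)
  obtain ⟨e₀, he₀, hXe₀⟩ := hc₁ {x | x ∈ [X]}
    ⟨rX, List.mem_of_getElem? hrX, [X], by simp [hrXt], rfl⟩
  have hXe₀ : X ∈ e₀ := hXe₀ (by simp)
  obtain ⟨u₀, hu₀, hu₀s⟩ := hcover ⟨e₀, he₀⟩
  obtain ⟨g₀, hg₀, hg₀X⟩ := hac.exists_support hws hvm hu₀ (g := fun _ => a)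
    (by simpa [hscX] using hva) ⟨X, by simp [hscX], hu₀s X hXe₀⟩
  obtain ⟨G, hGr, hGP, hG⟩ := exists_choice_of_joinTree hT hTac (fun x e => x ∈ e.1)
    (fun x e f => hjt x e f) P hstep ⟨e₀, he₀⟩ g₀
    (fun _ => ⟨u₀, hu₀, hu₀s, g₀, hg₀, fun _ _ => rfl⟩)
  let g : ℕ → ℕ := fun x => if h : ∃ e : Ha.edgeSet, x ∈ e.1 then G h.choose x else 0
  have hgG : ∀ (e : Ha.edgeSet) x, x ∈ e.1 → g x = G e x := by
    intro e x hx
    have h : ∃ e : Ha.edgeSet, x ∈ e.1 := ⟨e, hx⟩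
    simp only [g, dif_pos h]
    exact hG x _ _ h.choose_spec hx
  have hgbase : ∀ q ∈ baseIndices I.lhs V, ∀ u, S[q]? = some u → u.scope.map g ∈ u.tuples := by
    rintro q hqb u hu
    obtain ⟨v₀, hv₀, hus, -⟩ := hS.getElem? hu
    obtain ⟨hune, -⟩ := E.base_scope q hqb v₀ hv₀
    obtain ⟨i, j, r, t, hr, ht, hq⟩ := hqb
    have hut : u.scope = t := by rw [hus, hV.scope_eq hr ht hq hv₀]
    rw [← hus, hut] at hune
    obtain ⟨x, hx⟩ := List.exists_mem_of_ne_nil _ hune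
    obtain ⟨e, he, hte⟩ := hc₁ {x | x ∈ t} ⟨r, List.mem_of_getElem? hr, t, List.mem_of_getElem? ht, rfl⟩
    have hte : ∀ y ∈ t, y ∈ e := hte
    -- The covering view need not be the base view itself. A tuple of the covering view is supported
    -- in the base view, and the supporting tuple is the restriction of `g`.
    obtain ⟨w, hw, hws', g₁, hg₁, hgg⟩ := hGP ⟨e, he⟩ ⟨x, hte x hx⟩
    obtain ⟨g', hg', hgg'⟩ := hac.exists_support hws hw (List.mem_of_getElem? hu) hg₁
      ⟨x, hws' x (hte x hx), hut ▸ hx⟩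
    have : u.scope.map g = u.scope.map g' := by
      refine List.map_congr_left fun y hy => ?_
      have hyt : y ∈ t := hut ▸ hy
      rw [hgG ⟨e, he⟩ y (hte y hyt), ← hgg y (hte y hyt), hgg' y (hws' y (hte y hyt)) hy]
    rw [this]
    exact hg'
  refine ⟨g, E.sound g fun q hq v₀ hv₀ => ?_, ?_, fun Y hY w hw => ?_⟩
  · obtain ⟨u, hu, hus, husub⟩ := hS.getElem?' hv₀
    rw [← hus]
    exact husub.subset (hgbase q hq u hu)
  · rw [hgG ⟨e₀, he₀⟩ X hXe₀, hGr]
    exact (hg₀X X (by simp [hscX]) (hu₀s X hXe₀)).symm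
  · have := hgbase _ (E.dom Y hY).1 w hw
    obtain ⟨w', -, hw', hws', -⟩ := E.dom_view hS hY
    rw [hw] at hw'
    obtain rfl : w = w' := by simpa using hw'
    simpa [hws'] using this

end Legal

/-! ## The domain-restricted version -/

theorem findT_spec {α : Type} {f : α → Timed Bool} {l : List α} {i : ℕ}
    (h : (findT f l).val = some i) : ∃ a, l[i]? = some a ∧ (f a).val = true := by
  induction l generalizing i with
  | nil => simp [findT] at h
  | cons a l ih =>
    simp only [findT, timed_bind_val] at h
    split_ifs at h with hf
    · obtain rfl : 0 = i := by simpa [timed_pure_val] using h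
      exact ⟨a, by simp, hf⟩
    · obtain ⟨k, hk, rfl⟩ := Option.map_eq_some_iff.1 h
      simpa using ih hk

theorem isDomT_val {X : ℕ} {r : RelTable} (h : (isDomT X r).val = true) : r.tuples = [[X]] := by
  unfold isDomT at h
  split at h
  · next y hy =>
    obtain rfl : y = X := by simpa [eqT] using h
    exact hy
  · simp at h

theorem mem_freshDomainT {I : CSPInstance} (pick : ℕ → ℕ) {g : ℕ → ℕ} (hg : IsHom I.lhs I.rhs g)
    {X : ℕ} (hX : X < I.lhs.card) : g X ∈ (freshDomainT I pick X).val := by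
  simp only [freshDomainT, timed_bind_val]
  split
  · simpa [rangeT] using hg.1 X hX
  · next b k hbk =>
    have hmem := List.mem_of_getElem? hbk
    simp only [occurrencesT, timed_bind_val, flatMapT_val, List.mem_flatMap, filterT_val,
      mapT_val, zipT, rangeT, List.mem_map, List.mem_filter, List.mem_range] at hmem
    obtain ⟨p, hp, t, ht, k', ⟨hk', hX'⟩, heq⟩ := hmem
    obtain ⟨rfl, rfl⟩ := Prod.mk.inj heq
    rw [timed_bind_val, mem_dedupT, mapT_val]
    refine List.mem_map.2 ⟨_, hg.2 p hp t ht, ?_⟩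
    have hX' : t[k'] = X := by simpa [eqT, nthT, hk'] using hX'
    simp [nthT, hk', hX']

theorem mem_addDomains_lhs {I : CSPInstance} {pick : ℕ → ℕ} {r : RelTable} :
    r ∈ (I.addDomains pick).lhs.rels ↔
      r ∈ I.lhs.rels ∨ ∃ X < I.lhs.card, r = ⟨1, [[X]]⟩ := by
  simp [CSPInstance.addDomains, RelStructure.addUnary, eq_comm]

theorem length_rels_eq (I : CSPInstance) : I.lhs.rels.length = I.rhs.rels.length := by
  have := congrArg List.length I.same_vocabulary
  simpa [RelStructure.vocabulary] using this

/-- The fresh constraints remove no homomorphism: the selected column contains every value that a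
homomorphism can give to the variable. -/
theorem isHom_addDomains (I : CSPInstance) (pick : ℕ → ℕ) (g : ℕ → ℕ) :
    IsHom (I.addDomains pick).lhs (I.addDomains pick).rhs g ↔ IsHom I.lhs I.rhs g := by
  have hz : (I.addDomains pick).lhs.rels.zip (I.addDomains pick).rhs.rels =
      I.lhs.rels.zip I.rhs.rels ++ (List.range I.lhs.card).map fun X =>
        ((⟨1, [[X]]⟩ : RelTable),
          (⟨1, (freshDomainT I pick X).val.map fun x => [x]⟩ : RelTable)) := by
    simp only [CSPInstance.addDomains, RelStructure.addUnary, mapT_val]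
    rw [List.zip_append (length_rels_eq I)]
    congr 1
    rw [List.map_map, List.map_map, List.zip_map']
    simp
  constructor
  · rintro ⟨h1, h2⟩
    exact ⟨h1, fun p hp => h2 p (by rw [hz]; exact List.mem_append_left _ hp)⟩
  · intro h
    refine ⟨h.1, fun p hp => ?_⟩
    rw [hz] at hp
    rcases List.mem_append.1 hp with hp | hp
    · exact h.2 p hp
    · obtain ⟨X, hX, rfl⟩ := List.mem_map.1 hp
      intro t ht
      obtain rfl : t = [X] := by simpa using ht
      simpa using mem_freshDomainT pick h (by simpa using hX)

theorem edgeSet_addDomains (I : CSPInstance) (pick : ℕ → ℕ) (e : Set ℕ) :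
    e ∈ (I.addDomains pick).lhs.hypergraph.edgeSet ↔
      e ∈ I.lhs.hypergraph.edgeSet ∨ ∃ X < I.lhs.card, e = {X} := by
  constructor
  · rintro ⟨r, hr, t, ht, rfl⟩
    rcases mem_addDomains_lhs.1 hr with hr | ⟨X, hX, rfl⟩
    · exact Or.inl ⟨r, hr, t, ht, rfl⟩
    · obtain rfl : t = [X] := by simpa using ht
      exact Or.inr ⟨X, hX, by ext; simp⟩
  · rintro (⟨r, hr, t, ht, rfl⟩ | ⟨X, hX, rfl⟩)
    · exact ⟨r, mem_addDomains_lhs.2 (Or.inl hr), t, ht, rfl⟩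
    · exact ⟨_, mem_addDomains_lhs.2 (Or.inr ⟨X, hX, rfl⟩), [X], by simp, by ext; simp⟩

theorem isConnected_addDomains {I : CSPInstance} (pick : ℕ → ℕ)
    (h : IsConnected I.lhs.hypergraph) : IsConnected (I.addDomains pick).lhs.hypergraph := by
  refine ⟨h.1, fun e he => ?_, fun x hx y hy => ?_⟩
  · rcases (edgeSet_addDomains I pick e).1 he with he | ⟨X, -, rfl⟩
    · exact h.2.1 e he
    · exact Set.singleton_nonempty X
  · refine Relation.ReflTransGen.mono ?_ _ _ (h.2.2 x hx y hy)
    rintro a b ⟨e, he, hab⟩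
    exact ⟨e, (edgeSet_addDomains I pick e).2 (Or.inl he), hab⟩

theorem exists_edge_of_isConnected {A : RelStructure} (h : IsConnected A.hypergraph)
    (hc : 2 ≤ A.card) {X : ℕ} (hX : X < A.card) : ∃ e ∈ A.hypergraph.edgeSet, X ∈ e := by
  obtain ⟨Y, hY, hne⟩ : ∃ Y < A.card, Y ≠ X := by
    by_cases h0 : X = 0
    · exact ⟨1, by omega, by omega⟩
    · exact ⟨0, by omega, by omega⟩
  rcases (h.2.2 X hX Y hY).cases_head with rfl | ⟨z, ⟨e, he, hXe, -⟩, -⟩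
  · exact absurd rfl hne
  · exact ⟨e, he, hXe⟩

/-- With two variables or more, connectedness puts every variable into a hyperedge, so the added
singletons are covered already. An isolated single variable might lie in no hyperedge of the
projection. -/
theorem hasTreeProjection_addDomains {I : CSPInstance} (pick : ℕ → ℕ)
    (h : IsConnected I.lhs.hypergraph) (hc : 2 ≤ I.lhs.card) {H : Hypergraph ℕ}
    (ht : HasTreeProjection I.lhs.hypergraph H) :
    HasTreeProjection (I.addDomains pick).lhs.hypergraph H := by
  obtain ⟨Ha, h1, h2, h3⟩ := ht
  refine ⟨Ha, h1, fun e he => ?_, h3⟩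
  rcases (edgeSet_addDomains I pick e).1 he with he | ⟨X, hX, rfl⟩
  · exact h2 e he
  · obtain ⟨f, hf, hXf⟩ := exists_edge_of_isConnected h hc hX
    obtain ⟨k, hk, hfk⟩ := h2 f hf
    exact ⟨k, hk, Set.singleton_subset_iff.2 (hfk hXf)⟩

theorem domainRestrictedT_cases (I : CSPInstance) (pick : ℕ → ℕ) :
    ((domainRestrictedT I pick).val.1 = I ∨
      (domainRestrictedT I pick).val.1 = I.addDomains pick) ∧
    DomainSymbols (domainRestrictedT I pick).val.1.lhs (domainRestrictedT I pick).val.2 := by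
  simp only [domainRestrictedT, timed_bind_val, mapT_val, allT_val, rangeT]
  split_ifs with hok
  · refine ⟨Or.inl rfl, by simp [timed_bind_val, timed_pure_val, mapT_val], fun X hX => ?_⟩
    simp only [List.all_eq_true, List.mem_map, List.mem_range, forall_exists_index, and_imp,
      forall_apply_eq_imp_iff₂] at hok
    obtain ⟨i, hi⟩ := Option.isSome_iff_exists.1 (hok X hX)
    obtain ⟨r, hr, hd⟩ := findT_spec hi
    refine ⟨r, ?_, isDomT_val hd⟩
    have hX' : X < I.lhs.card := hX
    simpa [timed_bind_val, timed_pure_val, mapT_val, hX', hi] using hr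
  · refine ⟨Or.inr rfl, by simp [timed_bind_val, timed_pure_val, mapT_val,
      CSPInstance.addDomains, RelStructure.addUnary], fun X hX => ?_⟩
    have hX' : X < I.lhs.card := hX
    refine ⟨⟨1, [[X]]⟩, ?_, rfl⟩
    simp [timed_bind_val, timed_pure_val, mapT_val, CSPInstance.addDomains, RelStructure.addUnary,
      lengthT, hX']

/-! ## Delay -/

/-- The number of steps since the last output, after a trace that starts `k` steps after one. -/
def finalGap : ℕ → List (Option Event) → ℕ
  | k, [] => k
  | k, none :: l => finalGap (k + 1) l
  | _, some _ :: l => finalGap 0 l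

/-- The delay stays below `d` along a trace that starts `k` steps after the last output. -/
def GapLE (d : ℕ) : ℕ → List (Option Event) → Prop
  | k, [] => k ≤ d
  | k, none :: l => GapLE d (k + 1) l
  | k, some _ :: l => k ≤ d ∧ GapLE d 0 l

theorem GapLE.le {d k : ℕ} {l : List (Option Event)} (h : GapLE d k l) : k ≤ d := by
  induction l generalizing k with
  | nil => exact h
  | cons e l ih =>
    cases e with
    | none => have := ih h; omega
    | some e => exact h.1

theorem gapLE_append {d k : ℕ} {l l' : List (Option Event)} :
    GapLE d k (l ++ l') ↔ GapLE d k l ∧ GapLE d (finalGap k l) l' := by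
  induction l generalizing k with
  | nil => exact ⟨fun h => ⟨h.le, h⟩, fun h => h.2⟩
  | cons e l ih =>
    cases e with
    | none => exact ih
    | some e =>
      simp only [List.cons_append, GapLE, finalGap, ih, and_assoc]

theorem finalGap_append (k : ℕ) (l l' : List (Option Event)) :
    finalGap k (l ++ l') = finalGap (finalGap k l) l' := by
  induction l generalizing k with
  | nil => rfl
  | cons e l ih => cases e <;> exact ih _

theorem finalGap_replicate (k n : ℕ) : finalGap k (List.replicate n none) = k + n := by
  induction n generalizing k with
  | zero => rfl
  | succ n ih => rw [List.replicate_succ, finalGap, ih]; omega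

theorem gapLE_replicate {d k n : ℕ} : GapLE d k (List.replicate n none) ↔ k + n ≤ d := by
  induction n generalizing k with
  | zero => rfl
  | succ n ih => rw [List.replicate_succ, GapLE, ih]; omega

theorem gapLE_after {α : Type} {d k : ℕ} {x : Timed α} {K : α → Run} :
    GapLE d k (Run.after x K).trace ↔ GapLE d (k + x.steps) (K x.val).trace := by
  rw [Run.after, gapLE_append, finalGap_replicate, gapLE_replicate]
  exact ⟨fun h => h.2, fun h => ⟨h.le, h⟩⟩

theorem finalGap_after {α : Type} (k : ℕ) (x : Timed α) (K : α → Run) :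
    finalGap k (Run.after x K).trace = finalGap (k + x.steps) (K x.val).trace := by
  rw [Run.after, finalGap_append, finalGap_replicate]

theorem GapLE.hasDelay {R : Run} {d : ℕ} (h : GapLE d 0 R.trace) : R.HasDelay d := by
  intro l₁ l₂ k he
  rw [he, List.append_assoc, gapLE_append, gapLE_append, finalGap_replicate] at h
  have := h.2.2.le
  omega

/-- `B` is the time that a body may need to stay within the delay, and `f` bounds the gap that it
leaves behind. The added 1 is the loop's own step. An empty loop outputs nothing, so its final gap
is not controlled. -/
theorem forEach_gap {brk : Bool} {body : ℕ → Run} {l : List ℕ} {d B f : ℕ}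
    (hb : ∀ a ∈ l, ∀ k, k + B ≤ d → GapLE d k (body a).trace ∧ finalGap k (body a).trace ≤ f)
    (hf : f + 1 + B ≤ d) {k : ℕ} (hk : k + 1 + B ≤ d) :
    GapLE d k (forEach brk body l).trace ∧
      (l ≠ [] → finalGap k (forEach brk body l).trace ≤ f + 1) := by
  induction l generalizing k with
  | nil =>
    refine ⟨?_, fun h => absurd rfl h⟩
    change k + 1 ≤ d
    omega
  | cons a l ih =>
    obtain ⟨h1, h2⟩ := hb a (by simp) (k + 1) hk
    simp only [forEach]
    split_ifs
    · exact ⟨h1, fun _ => h2.trans (Nat.le_succ f)⟩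
    · obtain ⟨h3, h4⟩ := ih (fun b hb' => hb b (by simp [hb']))
        (k := finalGap (k + 1) (body a).trace) (by omega)
      simp only [List.cons_append]
      refine ⟨gapLE_append.2 ⟨h1, h3⟩, fun _ => ?_⟩
      rw [finalGap, finalGap_append]
      by_cases hl : l = []
      · subst hl
        change finalGap (k + 1) (body a).trace + 1 ≤ f + 1
        omega
      · exact h4 hl

/-- A level costs at most `2 * C + 1` on the way down: `C` before the loop, `C` for preparing the
recursive call, and one loop step. It costs one more step on the way up, whence `2 * C + 2`. Calls
after the first always output something, so only their loops have a bounded final gap. -/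
theorem SearchState.gap {dv vars : List ℕ} {S₀ : List View} {Sol : Set (ℕ → ℕ)} {base : Set ℕ}
    {m C d : ℕ} {done todo pre : List ℕ} {S : List View}
    (E : SearchSpace dv vars S₀ Sol base)
    (hC : ∀ (S : List View) (X : ℕ) (pre : List ℕ), SubViews S S₀ → X ∈ vars →
      pre.length < vars.length →
      (gacT S).steps + (isEmptyT (gacT S).val).steps + (nthT dv X 0).steps +
        (activeValuesT (dv.getD X 0) (gacT S).val).steps + 1 ≤ C ∧
      ∀ a, (appendT pre [a]).steps + (assignT (dv.getD X 0) a (gacT S).val).steps + 1 ≤ C)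
    (hd : vars.length * (2 * C + 2) ≤ d)
    (h : SearchState dv vars S₀ Sol done todo S pre) (ht : todo ≠ []) {k : ℕ}
    (hk : k + todo.length * (2 * C + 1) ≤ d) :
    GapLE d k (cPropagate dv m todo (done.length + 1) S pre).trace ∧
      (done ≠ [] → finalGap k (cPropagate dv m todo (done.length + 1) S pre).trace
        ≤ todo.length) := by
  induction todo generalizing done S pre k with
  | nil => exact absurd rfl ht
  | cons X todo ih =>
    have hX : X ∈ vars := by rw [h.vars_eq]; simp
    have hlen : done.length + (todo.length + 1) = vars.length := by simp [h.vars_eq]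
    have hlp := h.length_eq
    obtain ⟨hC1, hC2⟩ := hC S X pre h.sub hX (by omega)
    rw [cPropagate_cons, gapLE_after, gapLE_after, finalGap_after, finalGap_after]
    rw [List.length_cons, Nat.succ_mul] at hk
    have hn : todo.length * (2 * C + 1) + todo.length + (2 * C + 2) ≤ d := by
      have h1 : (todo.length + 1) * (2 * C + 2) ≤ vars.length * (2 * C + 2) :=
        Nat.mul_le_mul_right _ (by omega)
      have h2 : (todo.length + 1) * (2 * C + 2)
        = todo.length * (2 * C + 1) + todo.length + (2 * C + 2) := by ring
      omega
    simp only [isEmptyT_val]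
    split_ifs with hne
    · simp only [Run.fail, GapLE, finalGap]
      refine ⟨⟨by omega, by omega⟩, fun _ => by omega⟩
    · rw [gapLE_after, gapLE_after, finalGap_after, finalGap_after]
      have hbody : ∀ a ∈ (activeValuesT (dv.getD X 0) (gacT S).val).val, ∀ k,
          k + (C + todo.length * (2 * C + 1)) ≤ d →
          GapLE d k (branch dv m X todo (done.length + 1) (gacT S).val pre a).trace ∧
          finalGap k (branch dv m X todo (done.length + 1) (gacT S).val pre a).trace
            ≤ todo.length := by
        intro a ha k hk
        have hCa := hC2 a
        by_cases ht' : todo = []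
        · subst ht'
          rw [branch_nil]
          simp only [Run.output]
          rw [gapLE_append, gapLE_replicate, finalGap_replicate, finalGap_append]
          simp only [appendT, GapLE, finalGap, List.length_append, List.length_singleton] at hCa ⊢
          refine ⟨⟨by omega, by omega, by omega⟩, by omega⟩
        · rw [branch, if_neg ht', gapLE_after, gapLE_after, finalGap_after, finalGap_after]
          have := ih (h.next E ha) ht' (k := k + (appendT pre [a]).steps +
            (assignT (dv.getD X 0) a (gacT S).val).steps) (by omega)
          rw [List.length_append, List.length_singleton] at this
          exact ⟨this.1, this.2 (by simp)⟩
      obtain ⟨h1, h2⟩ := forEach_gap (brk := decide (m < done.length + 1)) hbody (by omega)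
        (k := k + (gacT S).steps + (isEmptyT (gacT S).val).steps + (nthT dv X 0).steps +
        (activeValuesT (dv.getD X 0) (gacT S).val).steps) (by omega)
      refine ⟨h1, fun hdn => h2 ?_⟩
      obtain ⟨v, hvm, -, -, -, hone, hact⟩ := E.dom_view h.gac_sub hX
      have := List.length_pos_iff.2 hdn
      -- After the first call, passing the failure test means that there is a value to try, and each
      -- value leads to an output.
      have hvt : v.tuples ≠ [] := fun hv' => hne ⟨by omega, v, hvm, hv'⟩
      obtain ⟨t, ht1⟩ := List.exists_mem_of_ne_nil _ hvt
      obtain ⟨b, rfl⟩ := hone t ht1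
      exact List.ne_nil_of_mem ((hact b).2 ht1)

/-! ## Step counts -/

theorem timed_bind_steps {α β : Type} (x : Timed α) (f : α → Timed β) :
    (x >>= f).steps = x.steps + (f x.val).steps := rfl

theorem timed_pure_steps {α : Type} (a : α) : (pure a : Timed α).steps = 0 := rfl

section Loops

variable {α β : Type} {l : List α} {n k : ℕ}

theorem loop_bound {a b n k : ℕ} (ha : a ≤ k) (hb : b ≤ n * (k + 1) + 1) :
    1 + (a + b) ≤ (n + 1) * (k + 1) + 1 := by
  rw [Nat.succ_mul]
  omega

theorem mapT_steps {f : α → Timed β} (hf : ∀ a ∈ l, (f a).steps ≤ k) (hl : l.length ≤ n) :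
    (mapT f l).steps ≤ n * (k + 1) + 1 := by
  induction l generalizing n with
  | nil => simp [mapT]
  | cons a l ih =>
    obtain ⟨n, rfl⟩ : ∃ n', n = n' + 1 := ⟨n - 1, by simp at hl; omega⟩
    simp only [mapT, timed_bind_steps, timed_pure_steps, tick, add_zero]
    exact loop_bound (hf a (by simp)) (ih (fun b hb => hf b (by simp [hb])) (by simpa using hl))

theorem filterT_steps {f : α → Timed Bool} (hf : ∀ a ∈ l, (f a).steps ≤ k) (hl : l.length ≤ n) :
    (filterT f l).steps ≤ n * (k + 1) + 1 := by
  induction l generalizing n with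
  | nil => simp [filterT]
  | cons a l ih =>
    obtain ⟨n, rfl⟩ : ∃ n', n = n' + 1 := ⟨n - 1, by simp at hl; omega⟩
    simp only [filterT, timed_bind_steps, timed_pure_steps, tick, add_zero]
    exact loop_bound (hf a (by simp)) (ih (fun b hb => hf b (by simp [hb])) (by simpa using hl))

theorem allT_steps {f : α → Timed Bool} (hf : ∀ a ∈ l, (f a).steps ≤ k) (hl : l.length ≤ n) :
    (allT f l).steps ≤ n * (k + 1) + 1 := by
  induction l generalizing n with
  | nil => simp [allT]
  | cons a l ih =>
    obtain ⟨n, rfl⟩ : ∃ n', n = n' + 1 := ⟨n - 1, by simp at hl; omega⟩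
    simp only [allT, timed_bind_steps, tick]
    refine loop_bound (hf a (by simp)) ?_
    split_ifs
    · exact ih (fun b hb => hf b (by simp [hb])) (by simpa using hl)
    · simp [timed_pure_steps]

theorem anyT_steps {f : α → Timed Bool} (hf : ∀ a ∈ l, (f a).steps ≤ k) (hl : l.length ≤ n) :
    (anyT f l).steps ≤ n * (k + 1) + 1 := by
  induction l generalizing n with
  | nil => simp [anyT]
  | cons a l ih =>
    obtain ⟨n, rfl⟩ : ∃ n', n = n' + 1 := ⟨n - 1, by simp at hl; omega⟩
    simp only [anyT, timed_bind_steps, tick]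
    refine loop_bound (hf a (by simp)) ?_
    split_ifs
    · simp [timed_pure_steps]
    · exact ih (fun b hb => hf b (by simp [hb])) (by simpa using hl)

theorem findT_steps {f : α → Timed Bool} (hf : ∀ a ∈ l, (f a).steps ≤ k) (hl : l.length ≤ n) :
    (findT f l).steps ≤ n * (k + 1) + 1 := by
  induction l generalizing n with
  | nil => simp [findT]
  | cons a l ih =>
    obtain ⟨n, rfl⟩ : ∃ n', n = n' + 1 := ⟨n - 1, by simp at hl; omega⟩
    simp only [findT, timed_bind_steps, tick]
    refine loop_bound (hf a (by simp)) ?_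
    split_ifs
    · simp [timed_pure_steps]
    · exact ih (fun b hb => hf b (by simp [hb])) (by simpa using hl)

/-- Appending costs the length of the piece, so lengths are bounded together with steps. -/
theorem flatMapT_steps {f : α → Timed (List β)} {w : ℕ}
    (hf : ∀ a ∈ l, (f a).steps ≤ k ∧ (f a).val.length ≤ w) (hl : l.length ≤ n) :
    (flatMapT f l).steps ≤ n * (k + (w + 1) + 1) + 1 ∧ (flatMapT f l).val.length ≤ n * w := by
  induction l generalizing n with
  | nil => simp [flatMapT]
  | cons a l ih =>
    obtain ⟨n, rfl⟩ : ∃ n', n = n' + 1 := ⟨n - 1, by simp at hl; omega⟩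
    obtain ⟨h1, h2⟩ := hf a (by simp)
    obtain ⟨h3, h4⟩ := ih (fun b hb => hf b (by simp [hb])) (n := n) (by simpa using hl)
    simp only [flatMapT, timed_bind_steps, timed_bind_val, tick, appendT, List.length_append]
    rw [Nat.succ_mul, Nat.succ_mul]
    omega

theorem dedupT_length (l : List ℕ) : (dedupT l).val.length ≤ l.length := by
  induction l with
  | nil => simp [dedupT]
  | cons a l ih =>
    simp only [dedupT, timed_bind_val, timed_pure_val]
    split_ifs <;> simp <;> omega

/-- The bound `n'` shrinks with the list in the induction, while `n` stays fixed to bound each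
membership test. -/
theorem dedupT_steps {l : List ℕ} {n' : ℕ} (hl : l.length ≤ n') (hn : n' ≤ n) :
    (dedupT l).steps ≤ n' * (n * (1 + 1) + 1 + 1) + 1 := by
  induction l generalizing n' with
  | nil => simp [dedupT]
  | cons a l ih =>
    obtain ⟨n', rfl⟩ : ∃ m, n' = m + 1 := ⟨n' - 1, by simp at hl; omega⟩
    have hl : l.length ≤ n' := by simpa using hl
    have hrec := ih hl (by omega)
    have hany := anyT_steps (f := eqT a) (k := 1) (n := n) (l := (dedupT l).val)
      (fun _ _ => le_rfl) (by have := dedupT_length l; omega)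
    simp only [dedupT, timed_bind_steps, timed_pure_steps, tick, add_zero]
    rw [Nat.succ_mul]
    omega

end Loops

/-! ## Polynomial functions -/

def IsPoly (f : ℕ → ℕ) : Prop := ∃ p : Polynomial ℕ, ∀ n, f n = p.eval n

theorem IsPoly.const (c : ℕ) : IsPoly fun _ => c := ⟨Polynomial.C c, by simp⟩

theorem IsPoly.id : IsPoly fun n => n := ⟨Polynomial.X, by simp⟩

theorem IsPoly.add {f g : ℕ → ℕ} (hf : IsPoly f) (hg : IsPoly g) : IsPoly fun n => f n + g n := by
  obtain ⟨p, hp⟩ := hf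
  obtain ⟨q, hq⟩ := hg
  exact ⟨p + q, by simp [hp, hq]⟩

theorem IsPoly.mul {f g : ℕ → ℕ} (hf : IsPoly f) (hg : IsPoly g) : IsPoly fun n => f n * g n := by
  obtain ⟨p, hp⟩ := hf
  obtain ⟨q, hq⟩ := hg
  exact ⟨p * q, by simp [hp, hq]⟩

theorem IsPoly.comp {f g : ℕ → ℕ} (hf : IsPoly f) (hg : IsPoly g) : IsPoly fun n => f (g n) := by
  obtain ⟨p, hp⟩ := hf
  obtain ⟨q, hq⟩ := hg
  exact ⟨p.comp q, by simp [hp, hq, Polynomial.eval_comp]⟩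

theorem isPoly_eval (p : Polynomial ℕ) : IsPoly fun n => p.eval n := ⟨p, fun _ => rfl⟩

theorem eval_mono (p : Polynomial ℕ) {a b : ℕ} (h : a ≤ b) : p.eval a ≤ p.eval b := by
  rw [Polynomial.eval_eq_sum_range, Polynomial.eval_eq_sum_range]
  exact Finset.sum_le_sum fun i _ => Nat.mul_le_mul_left _ (Nat.pow_le_pow_left h i)

/-! ## Steps of the propagation -/

/-- The number of views, the lengths of scopes, and the number and lengths of tuples. -/
def ViewsSizeLE (n : ℕ) (S : List View) : Prop :=
  S.length ≤ n ∧ ∀ v ∈ S, v.scope.length ≤ n ∧ v.tuples.length ≤ n ∧ ∀ t ∈ v.tuples, t.length ≤ n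

theorem ViewsSizeLE.subViews {n : ℕ} {S S' : List View} (h : ViewsSizeLE n S) (hs : SubViews S' S) :
    ViewsSizeLE n S' := by
  refine ⟨(List.Forall₂.length_eq hs).le.trans h.1, fun v' hv' => ?_⟩
  obtain ⟨v, hv, he, ht⟩ := hs.exists_of_mem hv'
  obtain ⟨h1, h2, h3⟩ := h.2 v hv
  exact ⟨he ▸ h1, ht.length_le.trans h2, fun t ht' => h3 t (ht.subset ht')⟩

def agreeBound (n : ℕ) : ℕ := n + n + 1 + (n + n + 1 + (n * (n * (1 + 1 + 1) + 1 + 1) + 1))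

theorem agreeT_steps {n : ℕ} {s b s' b' : List ℕ} (hs : s.length ≤ n) (hb : b.length ≤ n)
    (hs' : s'.length ≤ n) (hb' : b'.length ≤ n) : (agreeT s b s' b').steps ≤ agreeBound n := by
  simp only [agreeT, timed_bind_steps, agreeBound, zipT]
  refine Nat.add_le_add (by omega) (Nat.add_le_add (by omega) ?_)
  refine allT_steps (fun x _ => allT_steps (fun y _ => ?_) (by simp; omega)) (by simp; omega)
  refine Nat.add_le_add le_rfl ?_
  beta_reduce
  split_ifs
  · exact le_rfl
  · simp [timed_pure_steps]

def supportedBound (n : ℕ) : ℕ :=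
  (n * ((n * (1 + 1) + 1) + 1) + 1) + (n * (agreeBound n + 1) + 1)

theorem supportedT_steps {n : ℕ} {S : List View} (hS : ViewsSizeLE n S) {v v' : View} (hv : v ∈ S)
    (hv' : v' ∈ S) {b : List ℕ} (hb : b ∈ v.tuples) :
    (supportedT v b v').steps ≤ supportedBound n := by
  obtain ⟨h1, h2, h3⟩ := hS.2 v hv
  obtain ⟨h1', h2', h3'⟩ := hS.2 v' hv'
  simp only [supportedT, timed_bind_steps, supportedBound]
  refine Nat.add_le_add ?_ ?_
  · exact anyT_steps (fun x _ => anyT_steps (fun y _ => le_rfl) h1') h1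
  · split_ifs
    · exact anyT_steps (fun b' hb' => agreeT_steps h1 (h3 b hb) h1' (h3' b' hb')) h2'
    · simp [timed_pure_steps]

def filterPassBound (n : ℕ) : ℕ := n * (n * (n * (supportedBound n + 1) + 1 + 1) + 1 + 1) + 1

theorem filterPassT_steps {n : ℕ} {S : List View} (hS : ViewsSizeLE n S) :
    (filterPassT S).steps ≤ filterPassBound n := by
  refine mapT_steps (fun v hv => ?_) hS.1
  simp only [timed_bind_steps, timed_pure_steps, add_zero]
  exact filterT_steps (fun b hb => allT_steps (fun v' hv' => supportedT_steps hS hv hv' hb) hS.1)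
    (hS.2 v hv).2.1

def countBound (n : ℕ) : ℕ := n * (n + 1 + 1) + 1

theorem countT_steps {n : ℕ} {S : List View} (hS : ViewsSizeLE n S) :
    (countT S).steps ≤ countBound n := by
  suffices h : ∀ (S : List View) m, S.length ≤ m → (∀ v ∈ S, v.tuples.length ≤ n) →
      (countT S).steps ≤ m * (n + 1 + 1) + 1 from h S n hS.1 fun v hv => (hS.2 v hv).2.1
  intro S
  induction S with
  | nil => intro m _ _; simp [countT]
  | cons v S ih =>
    intro m hm hv
    obtain ⟨m, rfl⟩ : ∃ m', m = m' + 1 := ⟨m - 1, by simp at hm; omega⟩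
    simp only [countT, timed_bind_steps, timed_pure_steps, tick, lengthT, add_zero]
    exact loop_bound (by have := hv v (by simp); omega)
      (ih m (by simpa using hm) fun w hw => hv w (by simp [hw]))

theorem countT_val_le {n : ℕ} {S : List View} (hS : ViewsSizeLE n S) : (countT S).val ≤ n * n := by
  rw [countT_val]
  refine (List.sum_le_card_nsmul _ n ?_).trans ?_
  · intro x hx
    obtain ⟨v, hv, rfl⟩ := List.mem_map.1 hx
    exact (hS.2 v hv).2.1
  · simpa using Nat.mul_le_mul_right n hS.1

def gacBound (n : ℕ) : ℕ :=
  countBound n + (n * n + 1) * (countBound n + (filterPassBound n + (countBound n + 1)))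

theorem gacLoopT_steps {n k : ℕ} {S : List View} (hS : ViewsSizeLE n S) :
    (gacLoopT k S).steps ≤ k * (countBound n + (filterPassBound n + (countBound n + 1))) := by
  induction k generalizing S with
  | zero => simp [gacLoopT, timed_pure_steps]
  | succ k ih =>
    have hS' := hS.subViews (filterPassT_subViews S)
    have h1 := countT_steps hS
    have h2 := filterPassT_steps hS
    have h3 := countT_steps hS'
    have h4 := ih hS'
    simp only [gacLoopT, timed_bind_steps, eqT]
    rw [Nat.succ_mul]
    split_ifs
    · rw [timed_pure_steps]
      omega
    · omega

theorem gacT_steps {n : ℕ} {S : List View} (hS : ViewsSizeLE n S) :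
    (gacT S).steps ≤ gacBound n := by
  simp only [gacT, timed_bind_steps, gacBound]
  refine Nat.add_le_add (countT_steps hS) ((gacLoopT_steps hS).trans ?_)
  exact Nat.mul_le_mul_right _ (Nat.succ_le_succ (countT_val_le hS))

/-- A bound on the steps of one call of `cPropagate`, without the recursive calls. -/
def callBound (n : ℕ) : ℕ :=
  gacBound n + (n * (1 + 1) + 1) + (n + 1) + (n + 1 + (n * (1 + 1) + 1)) + 1 + (n + 1) + (n + 1)

theorem callBound_spec {dv vars : List ℕ} {S₀ : List View} {Sol : Set (ℕ → ℕ)} {base : Set ℕ}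
    {n : ℕ} (E : SearchSpace dv vars S₀ Sol base) (hn : ViewsSizeLE n S₀) (hX : ∀ X ∈ vars, X ≤ n)
    (hv : vars.length ≤ n) (S : List View) (X : ℕ) (pre : List ℕ) (hS : SubViews S S₀)
    (hXv : X ∈ vars) (hpre : pre.length < vars.length) :
    (gacT S).steps + (isEmptyT (gacT S).val).steps + (nthT dv X 0).steps +
        (activeValuesT (dv.getD X 0) (gacT S).val).steps + 1 ≤ callBound n ∧
      ∀ a, (appendT pre [a]).steps + (assignT (dv.getD X 0) a (gacT S).val).steps + 1
        ≤ callBound n := by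
  have hg := (gacT_subViews S).trans hS
  have h1 := hn.subViews hS
  have h2 := hn.subViews hg
  obtain ⟨v, hvm, hvq, -⟩ := E.dom_view hg hXv
  -- Access to a cell costs its index, which is bounded by the number of views because the domain
  -- view exists.
  have hq : dv.getD X 0 < (gacT S).val.length := (List.getElem?_eq_some_iff.1 hvq).1
  have hl := h2.1
  have ha := gacT_steps h1
  have hb : (isEmptyT (gacT S).val).steps ≤ n * (1 + 1) + 1 := anyT_steps (fun _ _ => le_rfl) hl
  have hc : (activeValuesT (dv.getD X 0) (gacT S).val).steps ≤ n + 1 + (n * (1 + 1) + 1) := by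
    simp only [activeValuesT, timed_bind_steps]
    refine Nat.add_le_add (by simp only [nthT]; omega) (mapT_steps (fun t _ => le_rfl) ?_)
    have : (nthT (gacT S).val (dv.getD X 0) ⟨[], []⟩).val = v := by
      simp only [nthT]
      rw [List.getD_eq_getElem?_getD, hvq]
      rfl
    rw [this]
    exact (h2.2 v hvm).2.1
  have hXn := hX X hXv
  simp only [callBound, nthT, appendT, assignT]
  exact ⟨by omega, fun a => by omega⟩

/-! ## Sizes of encodings -/

theorem length_encNat (k : ℕ) : (encNat k).length = k + 1 := by simp [encNat]

section EncList

variable {α : Type} {enc : α → List Bool} {l : List α}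

theorem length_le_encList : l.length ≤ (encList enc l).length := by
  simp only [encList, List.length_append, length_encNat]
  omega

theorem mem_le_encList {a : α} (h : a ∈ l) : (enc a).length ≤ (encList enc l).length := by
  have : (enc a).length ≤ (l.flatMap enc).length := by
    rw [List.length_flatMap]
    exact List.le_sum_of_mem (List.mem_map.2 ⟨a, h, rfl⟩)
  simp only [encList, List.length_append]
  omega

theorem encList_length_le {n k : ℕ} (hl : l.length ≤ n) (h : ∀ a ∈ l, (enc a).length ≤ k) :
    (encList enc l).length ≤ n + 1 + n * k := by
  have : (l.flatMap enc).length ≤ l.length * k := by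
    rw [List.length_flatMap]
    refine (List.sum_le_card_nsmul _ k ?_).trans (by simp)
    intro x hx
    obtain ⟨a, ha, rfl⟩ := List.mem_map.1 hx
    exact h a ha
  have h2 := Nat.mul_le_mul_right k hl
  simp only [encList, List.length_append, length_encNat]
  omega

end EncList

/-- The cardinality, the number and lengths of the relations, and their encodings. -/
structure StructureSizeLE (n : ℕ) (A : RelStructure) : Prop where
  card_le : A.card ≤ n
  length_le : A.rels.length ≤ n
  tuples_le : ∀ r ∈ A.rels, r.tuples.length ≤ n
  tuple_le : ∀ r ∈ A.rels, ∀ t ∈ r.tuples, t.length ≤ n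
  encode_le : ∀ r ∈ A.rels, r.encode.length ≤ n

theorem structureSizeLE {n : ℕ} {A : RelStructure} (h : A.encode.length ≤ n) :
    StructureSizeLE n A := by
  have h0 : A.encode.length = A.card + 1 + (encList RelTable.encode A.rels).length := by
    simp [RelStructure.encode, length_encNat]
  have h1 : ∀ r ∈ A.rels, r.encode.length ≤ n := fun r hr => by
    have := mem_le_encList (enc := RelTable.encode) hr
    omega
  have h2 : ∀ r ∈ A.rels, (encList encTuple r.tuples).length ≤ n := fun r hr => by
    have := h1 r hr
    simp only [RelTable.encode, List.length_append] at this
    omega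
  refine ⟨by omega, ?_, fun r hr => length_le_encList.trans (h2 r hr), fun r hr t ht => ?_, h1⟩
  · have := length_le_encList (enc := RelTable.encode) (l := A.rels)
    omega
  · exact length_le_encList.trans ((mem_le_encList (enc := encTuple) ht).trans (h2 r hr))

theorem freshDomainT_length_le {I : CSPInstance} (pick : ℕ → ℕ) (X : ℕ) :
    (freshDomainT I pick X).val.length ≤ I.rhs.card := by
  have h : (freshDomainT I pick X).val.Subperm (List.range I.rhs.card) :=
    (freshDomainT_nodup I pick X).subperm fun x hx =>
      List.mem_range.2 (freshDomainT_lt I pick X x hx)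
  simpa using h.length_le

/-- At most `n` old and `n` fresh relations; a fresh one has at most `n` tuples, each encoded by at
most `n + 4` bits. -/
def structBound (n : ℕ) : ℕ := n + 1 + (n + n + 1 + (n + n) * (n + (n + n * (n + 4) + 4)))

theorem encode_addUnary_le {n : ℕ} {A : RelStructure} (hA : StructureSizeLE n A)
    {ds : List (List ℕ)} (hds : ∀ d ∈ ds, d.Nodup ∧ ∀ x ∈ d, x < A.card)
    (hl : ds.length ≤ n) (hd : ∀ d ∈ ds, d.length ≤ n) :
    (A.addUnary ds hds).encode.length ≤ structBound n := by
  have hc := hA.card_le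
  simp only [RelStructure.encode, RelStructure.addUnary, List.length_append, length_encNat,
    structBound]
  refine Nat.add_le_add (by omega) ?_
  refine encList_length_le (by have := hA.length_le; simp; omega) fun r hr => ?_
  rcases List.mem_append.1 hr with hr | hr
  · have := hA.encode_le r hr
    omega
  · obtain ⟨d, hd', rfl⟩ := List.mem_map.1 hr
    simp only [RelTable.encode, List.length_append, length_encNat]
    have := encList_length_le (enc := encTuple) (l := d.map fun x => [x]) (n := n) (k := n + 4)
      (by simpa using hd d hd') (by
        intro t ht
        obtain ⟨x, hx, rfl⟩ := List.mem_map.1 ht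
        have := (hds d hd').2 x hx
        simp [encTuple, encList, length_encNat]
        omega)
    omega

theorem le_structBound (n : ℕ) : n ≤ structBound n := by
  simp only [structBound]
  omega

theorem encode_domainRestrictedT_le {I : CSPInstance} {n : ℕ} (h : I.encode.length ≤ n)
    (pick : ℕ → ℕ) :
    (domainRestrictedT I pick).val.1.lhs.encode.length ≤ structBound n ∧
      (domainRestrictedT I pick).val.1.rhs.encode.length ≤ structBound n := by
  simp only [CSPInstance.encode, List.length_append] at h
  have hl : StructureSizeLE n I.lhs := structureSizeLE (by omega)
  have hr : StructureSizeLE n I.rhs := structureSizeLE (by omega)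
  have hn := le_structBound n
  rcases (domainRestrictedT_cases I pick).1 with he | he <;> rw [he]
  · exact ⟨by omega, by omega⟩
  · refine ⟨encode_addUnary_le hl (by simp) (by simpa using hl.card_le) ?_,
      encode_addUnary_le hr (fun d hd => ?_) (by simpa [mapT_val] using hl.card_le) ?_⟩
    · intro d hd
      obtain ⟨X, hX, rfl⟩ := List.mem_map.1 hd
      have := hl.card_le
      have := List.mem_range.1 hX
      simp only [List.length_singleton]
      omega
    · rw [mapT_val] at hd
      obtain ⟨X, hX, rfl⟩ := List.mem_map.1 hd
      exact ⟨freshDomainT_nodup I pick X, freshDomainT_lt I pick X⟩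
    · intro d hd
      rw [mapT_val] at hd
      obtain ⟨X, hX, rfl⟩ := List.mem_map.1 hd
      exact (freshDomainT_length_le pick X).trans hr.card_le

/-! ## Steps of the domain restriction -/

def occurrencesBound (n : ℕ) : ℕ :=
  n + n + 1 + (n * ((n * ((n + 1 + ((n * (n + 1 + 1 + 1) + 1) + (n * (1 + 1) + 1))) + (n + 1) + 1)
    + 1) + (n * n + 1) + 1) + 1)

theorem occurrencesT_steps {I : CSPInstance} {n : ℕ} (hl : StructureSizeLE n I.lhs)
    (hr : StructureSizeLE n I.rhs) (X : ℕ) :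
    (occurrencesT I X).steps ≤ occurrencesBound n ∧
      (occurrencesT I X).val.length ≤ n * (n * n) := by
  have h1 := hl.length_le
  have h2 := hr.length_le
  have key := flatMapT_steps (l := I.lhs.rels.zip I.rhs.rels) (n := n) (w := n * n)
    (k := n * ((n + 1 + ((n * (n + 1 + 1 + 1) + 1) + (n * (1 + 1) + 1))) + (n + 1) + 1) + 1)
    (f := fun p => flatMapT (fun t => do
      let ks ← rangeT t.length
      let hits ← filterT (fun k => do let y ← nthT t k 0; eqT y X) ks
      mapT (fun k => (⟨(p.2, k), 1⟩ : Timed (RelTable × ℕ))) hits) p.1.tuples)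
    (fun p hp => by
      have hpm := (List.of_mem_zip hp).1
      refine flatMapT_steps (n := n) (w := n)
        (k := n + 1 + ((n * (n + 1 + 1 + 1) + 1) + (n * (1 + 1) + 1))) (fun t ht => ?_)
        (hl.tuples_le _ hpm)
      have htn := hl.tuple_le _ hpm t ht
      have hf : (filterT (fun k => do let y ← nthT t k 0; eqT y X) (List.range t.length)).val.length
          ≤ n := by
        rw [filterT_val]
        exact (List.length_filter_le _ _).trans (by simpa using htn)
      simp only [timed_bind_steps, timed_bind_val, rangeT]
      refine ⟨Nat.add_le_add (Nat.succ_le_succ htn) (Nat.add_le_add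
        (filterT_steps (fun k hk => ?_) (by simpa using htn)) (mapT_steps (fun _ _ => le_rfl) hf)),
        ?_⟩
      · have := List.mem_range.1 hk
        simp only [timed_bind_steps, nthT, eqT]
        omega
      · rw [mapT_val, List.length_map]
        exact hf) (by rw [List.length_zip]; omega)
  refine ⟨?_, key.2⟩
  simp only [occurrencesT, timed_bind_steps, occurrencesBound]
  exact Nat.add_le_add (by simp only [zipT]; omega) key.1

def freshDomainBound (n : ℕ) : ℕ :=
  occurrencesBound n + (n * (n * n) + 1 + (n + 1 + ((n * (n + 1 + 1) + 1) +
    (n * (n * (1 + 1) + 1 + 1) + 1))))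

theorem freshDomainT_steps {I : CSPInstance} {n : ℕ} (hl : StructureSizeLE n I.lhs)
    (hr : StructureSizeLE n I.rhs) (pick : ℕ → ℕ) (X : ℕ) :
    (freshDomainT I pick X).steps ≤ freshDomainBound n := by
  obtain ⟨h1, h2⟩ := occurrencesT_steps hl hr X
  simp only [freshDomainT, timed_bind_steps, freshDomainBound]
  refine Nat.add_le_add h1 (Nat.add_le_add (Nat.succ_le_succ h2) ?_)
  split
  · have := hr.card_le
    simp only [rangeT]
    omega
  · next b k hbk =>
    have hmem := List.mem_of_getElem? hbk
    simp only [occurrencesT, timed_bind_val, flatMapT_val, List.mem_flatMap, filterT_val,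
      mapT_val, zipT, rangeT, List.mem_map, List.mem_filter, List.mem_range] at hmem
    obtain ⟨p, hp, t, ht, k', ⟨hk', -⟩, heq⟩ := hmem
    obtain ⟨rfl, rfl⟩ := Prod.mk.inj heq
    have hb := hr.tuples_le _ (List.of_mem_zip hp).2
    have hk := hl.tuple_le _ (List.of_mem_zip hp).1 t ht
    simp only [timed_bind_steps]
    refine le_add_left (Nat.add_le_add (mapT_steps (fun u _ => ?_) hb) ?_)
    · simp only [nthT]
      omega
    · exact dedupT_steps (by rw [mapT_val]; simpa using hb) le_rfl

def domainRestrictedBound (n : ℕ) : ℕ :=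
  n + 1 + ((n * (n * (1 + 1) + 1 + 1) + 1) + ((n * (1 + 1) + 1) + ((n * (1 + 1) + 1) +
    (n * (freshDomainBound n + 1) + 1) + (n * (n * (1 + 1) + 1 + 1) + 1) + 4 * n + (n + 1) +
    (n * (1 + 1) + 1))))

theorem ite_steps_le {α : Type} {c : Prop} [Decidable c] {x y : Timed α} {k : ℕ}
    (hx : x.steps ≤ k) (hy : y.steps ≤ k) : (if c then x else y).steps ≤ k := by
  split_ifs <;> assumption

theorem isDomT_steps (X : ℕ) (r : RelTable) : (isDomT X r).steps ≤ 1 := by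
  unfold isDomT
  split <;> simp [eqT]

theorem domainRestrictedT_steps {I : CSPInstance} {n : ℕ} (hl : StructureSizeLE n I.lhs)
    (hr : StructureSizeLE n I.rhs) (pick : ℕ → ℕ) :
    (domainRestrictedT I pick).steps ≤ domainRestrictedBound n := by
  have hc := hl.card_le
  have hll := hl.length_le
  have hrl := hr.length_le
  have hrange : (List.range I.lhs.card).length ≤ n := by simpa using hc
  have h1 := mapT_steps (f := fun X => findT (isDomT X) I.lhs.rels)
    (fun X _ => findT_steps (fun r _ => isDomT_steps X r) hll) hrange
  have hds : (mapT (fun X => findT (isDomT X) I.lhs.rels) (List.range I.lhs.card)).val.length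
      ≤ n := by
    rw [mapT_val, List.length_map]
    exact hrange
  have h2 := allT_steps (k := 1) (f := fun d : Option ℕ => (⟨d.isSome, 1⟩ : Timed Bool))
    (fun _ _ => le_rfl) hds
  have h3 := mapT_steps (k := 1) (f := fun d : Option ℕ => (⟨d.getD 0, 1⟩ : Timed ℕ))
    (fun _ _ => le_rfl) hds
  have h4 := mapT_steps (f := freshDomainT I pick)
    (fun X _ => freshDomainT_steps hl hr pick X) hrange
  have h5 := mapT_steps (n := n) (k := n * (1 + 1) + 1)
    (f := fun d : List ℕ => mapT (fun x => (⟨[x], 1⟩ : Timed (List ℕ))) d)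
    (l := (mapT (freshDomainT I pick) (List.range I.lhs.card)).val)
    (fun d hd => mapT_steps (fun _ _ => le_rfl) (by
      rw [mapT_val] at hd
      obtain ⟨X, -, rfl⟩ := List.mem_map.1 hd
      exact (freshDomainT_length_le pick X).trans hr.card_le))
    (by rw [mapT_val, List.length_map]; exact hrange)
  have h6 := mapT_steps (k := 1) (f := fun X => (⟨I.lhs.rels.length + X, 1⟩ : Timed ℕ))
    (fun _ _ => le_rfl) hrange
  simp only [domainRestrictedT, timed_bind_steps, domainRestrictedBound]
  refine Nat.add_le_add (Nat.succ_le_succ hc) (Nat.add_le_add h1 (Nat.add_le_add h2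
    (ite_steps_le ?_ ?_)))
  · simp only [timed_bind_steps, timed_pure_steps, rangeT]
    omega
  · simp only [rangeT] at *
    simp only [timed_bind_steps, timed_pure_steps, tick, lengthT]
    omega

/-! ## The algorithm -/

theorem domainRestrictedT_spec (I : CSPInstance) (pick : ℕ → ℕ)
    (hc : IsConnected I.lhs.hypergraph) :
    (domainRestrictedT I pick).val.1.lhs.card = I.lhs.card ∧
    (∀ g, IsHom (domainRestrictedT I pick).val.1.lhs (domainRestrictedT I pick).val.1.rhs g ↔
      IsHom I.lhs I.rhs g) ∧
    IsConnected (domainRestrictedT I pick).val.1.lhs.hypergraph ∧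
    ∀ H, 2 ≤ I.lhs.card → HasTreeProjection I.lhs.hypergraph H →
      HasTreeProjection (domainRestrictedT I pick).val.1.lhs.hypergraph H := by
  rcases (domainRestrictedT_cases I pick).1 with h | h <;> rw [h]
  · exact ⟨rfl, fun _ => Iff.rfl, hc, fun _ _ h => h⟩
  · exact ⟨rfl, isHom_addDomains I pick, isConnected_addDomains pick hc,
      fun _ h2 h => hasTreeProjection_addDomains pick hc h2 h⟩

theorem ECSPInstance.restT_val (I : ECSPInstance) :
    I.restT.val = (List.range I.lhs.card).filter (fun x => x ∉ I.out) := by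
  simp only [ECSPInstance.restT, timed_bind_val, filterT_val, anyT_val, timed_pure_val, rangeT]
  refine List.filter_congr fun x _ => ?_
  by_cases h : x ∈ I.out
  · simp [h, eqT]
  · simp only [h, eqT, not_false_eq_true, decide_true, Bool.not_eq_true', List.any_eq_false,
      beq_iff_eq]
    exact fun y hy hxy => h (hxy ▸ hy)

/-- The variables in the order of the search. -/
def ECSPInstance.vars (I : ECSPInstance) : List ℕ := I.out ++ I.restT.val

theorem ECSPInstance.mem_vars (I : ECSPInstance) {x : ℕ} : x ∈ I.vars ↔ x < I.lhs.card := by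
  rw [vars, restT_val, List.mem_append, List.mem_filter, List.mem_range]
  have := I.out_lt x
  by_cases h : x ∈ I.out <;> simp [h]
  exact this h

theorem ECSPInstance.vars_nodup (I : ECSPInstance) : I.vars.Nodup := by
  rw [vars, restT_val]
  refine List.nodup_append.2 ⟨I.out_nodup, List.nodup_range.filter _, ?_⟩
  rintro x hx _ hy rfl
  simpa [hx] using (List.mem_filter.1 hy).2

theorem ECSPInstance.length_vars (I : ECSPInstance) : I.vars.length = I.lhs.card := by
  have : I.vars.Perm (List.range I.lhs.card) :=
    (List.perm_ext_iff_of_nodup I.vars_nodup List.nodup_range).2 fun x => by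
      rw [I.mem_vars, List.mem_range]
  simpa using this.length_eq

section Algorithm

variable (DM : DecompositionMethod) (pick : ℕ → ℕ) (I : ECSPInstance)

/-- The domain-restricted version of the input. -/
def ECSPInstance.restricted : CSPInstance := (domainRestrictedT I.toCSPInstance pick).val.1

/-- The symbols of the domain constraints. -/
def ECSPInstance.doms : List ℕ := (domainRestrictedT I.toCSPInstance pick).val.2

/-- The initial views. -/
def DecompositionMethod.views : List View :=
  (initViewsT (DM.ell (I.restricted pick).lhs) (DM.r (I.restricted pick))).val

/-- The indices of the domain views. -/
def DecompositionMethod.domViews : List ℕ :=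
  (domViewsT (DM.ell (I.restricted pick).lhs) (I.doms pick)).val

/-- The search that the algorithm starts. -/
def DecompositionMethod.search : Run :=
  cPropagate (DM.domViews pick I) I.out.length I.vars 1 (DM.views pick I) []

theorem computeCertifiedSolutions_outputs :
    (computeCertifiedSolutions DM pick I).outputs = (DM.search pick I).outputs := by
  simp only [computeCertifiedSolutions, Run.after_outputs]
  rfl

theorem computeCertifiedSolutions_projected :
    (computeCertifiedSolutions DM pick I).projected = (DM.search pick I).projected := by
  rw [Run.projected, computeCertifiedSolutions_outputs]
  rfl

variable {I}

theorem DecompositionMethod.searchSpace (hc : IsConnected I.lhs.hypergraph) :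
    SearchSpace (DM.domViews pick I) I.vars (DM.views pick I) {g | IsHom I.lhs I.rhs g}
      (baseIndices (I.restricted pick).lhs (DM.ell (I.restricted pick).lhs)) := by
  obtain ⟨h1, h2, h3, -⟩ := domainRestrictedT_spec I.toCSPInstance pick hc
  have := CertEnum.searchSpace (DM.ell_view _) (DM.r_legal (I.restricted pick))
    (domainRestrictedT_cases I.toCSPInstance pick).2 h3.2.1 I.vars_nodup
    (fun x => by rw [I.mem_vars]; exact iff_of_eq (congrArg _ h1.symm))
  have hs : {g | IsHom (I.restricted pick).lhs (I.restricted pick).rhs g} =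
      {g | IsHom I.lhs I.rhs g} := Set.ext h2
  rw [hs] at this
  exact this

theorem DecompositionMethod.searchState (hc : IsConnected I.lhs.hypergraph) :
    SearchState (DM.domViews pick I) I.vars (DM.views pick I) {g | IsHom I.lhs I.rhs g}
      [] I.vars (DM.views pick I) [] :=
  ⟨rfl, rfl, SubViews.refl _, by simp, fun g hg _ => (DM.searchSpace pick hc).complete g hg⟩

theorem DecompositionMethod.no_failure (hc : IsConnected I.lhs.hypergraph)
    (ht : HasTreeProjection I.lhs.hypergraph (DM.viewHypergraph pick I)) :
    Event.failure ∉ (DM.search pick I).outputs := by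
  obtain ⟨h1, h2, h3, h4⟩ := domainRestrictedT_spec I.toCSPInstance pick hc
  -- With a single variable the tree projection might not cover the fresh domain constraint, but
  -- then no call after the first takes place.
  by_cases hcard : 2 ≤ I.lhs.card
  · have hext := extendable_of_hasTreeProjection (DM.ell_view _) (DM.r_legal (I.restricted pick))
      (domainRestrictedT_cases I.toCSPInstance pick).2 h3 I.vars_nodup
      (fun x => by rw [I.mem_vars]; exact iff_of_eq (congrArg _ h1.symm)) (h4 _ hcard ht)
    have hs : {g | IsHom (I.restricted pick).lhs (I.restricted pick).rhs g} =
        {g | IsHom I.lhs I.rhs g} := Set.ext h2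
    rw [hs] at hext
    exact (DM.searchState pick hc).no_failure (DM.searchSpace pick hc) hext (Or.inl rfl)
  · obtain ⟨x, hx⟩ := hc.1
    have hx : x < I.lhs.card := hx
    have hl := I.length_vars
    obtain ⟨X, hX⟩ := List.length_eq_one_iff.1 (show I.vars.length = 1 by omega)
    rw [search, hX]
    exact no_failure_singleton _ _ _ _ _

theorem IsCertificate.of_vars {g : ℕ → ℕ} (hg : IsHom I.lhs I.rhs g) :
    (I.vars.map g).take I.out.length ∈ I.solutions I.out ∧
      I.IsCertificate ((I.vars.map g).take I.out.length) ((I.vars.map g).drop I.out.length) := by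
  have h1 : (I.vars.map g).take I.out.length = I.out.map g := by
    rw [ECSPInstance.vars, List.map_append]
    simp
  have h2 : (I.vars.map g).drop I.out.length = I.restT.val.map g := by
    rw [ECSPInstance.vars, List.map_append]
    simp
  rw [h1, h2, ECSPInstance.restT_val]
  exact ⟨⟨g, hg, rfl⟩, g, hg, rfl, rfl⟩

end Algorithm

/-! ## The polynomial delay -/

theorem exists_call_bound {α β : Type} {ea : α → List Bool} {eb : β → List Bool} {f : α → β}
    (h : Turing.TM2ComputableInPolyTime ea eb f) :
    ∃ q : ℕ → ℕ, IsPoly q ∧ ∀ n a, (ea a).length ≤ n →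
      (ea a).length + (h.outputsFun a).steps + (eb (f a)).length ≤ q n := by
  obtain ⟨m, hm⟩ := exists_output_length_le h
  refine ⟨fun n => n + h.time.eval n + (n + h.time.eval n * m), ?_, fun n a ha => ?_⟩
  · exact (IsPoly.id.add (isPoly_eval _)).add (IsPoly.id.add ((isPoly_eval _).mul (IsPoly.const m)))
  · have h1 := eval_mono h.time ha
    have h2 := Nat.mul_le_mul_right m h1
    have h3 := (h.outputsFun a).steps_le_m
    have h4 := hm a
    beta_reduce
    omega

theorem IsPoly.callBound : IsPoly callBound := by
  unfold CertEnum.callBound gacBound filterPassBound supportedBound agreeBound countBound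
  repeat with_reducible first
    | exact IsPoly.const _ | exact IsPoly.id | refine IsPoly.add ?_ ?_ | refine IsPoly.mul ?_ ?_

theorem IsPoly.structBound : IsPoly structBound := by
  unfold CertEnum.structBound
  repeat with_reducible first
    | exact IsPoly.const _ | exact IsPoly.id | refine IsPoly.add ?_ ?_ | refine IsPoly.mul ?_ ?_

theorem IsPoly.domainRestrictedBound : IsPoly domainRestrictedBound := by
  unfold CertEnum.domainRestrictedBound freshDomainBound occurrencesBound
  repeat with_reducible first
    | exact IsPoly.const _ | exact IsPoly.id | refine IsPoly.add ?_ ?_ | refine IsPoly.mul ?_ ?_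

/-- A bound on the steps before the search and on the delay of the search, in terms of the size `n`
of the input and a bound `N` on the sizes of the views. -/
def delayBound (n N : ℕ) : ℕ :=
  (n + 1 + (n * (n * (1 + 1) + 1 + 1) + 1)) + (n + 1) + (n + 1) + domainRestrictedBound n + N + N +
    (N + N + 1 + (N * (1 + 1) + 1)) + (N * (N + 1 + 1 + 1) + 1) + N * (2 * callBound N + 2)

theorem gap_computeCertifiedSolutions (DM : DecompositionMethod) {I : ECSPInstance} {pick : ℕ → ℕ}
    {N : ℕ} (hc : IsConnected I.lhs.hypergraph) (hn : I.size ≤ N)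
    (hV : (DM.callEll (I.restricted pick).lhs).steps ≤ N)
    (hBV : (DM.callR (I.restricted pick)).steps ≤ N) :
    GapLE (delayBound I.size N) 0 (computeCertifiedSolutions DM pick I).trace := by
  have hsize : I.lhs.encode.length + I.rhs.encode.length + (encTuple I.out).length = I.size := by
    simp only [ECSPInstance.size, ECSPInstance.encode, CSPInstance.encode, List.length_append]
  have hl : StructureSizeLE I.size I.lhs := structureSizeLE (by omega)
  have hr : StructureSizeLE I.size I.rhs := structureSizeLE (by omega)
  have hout : I.out.length ≤ I.size := by
    have : I.out.length ≤ (encTuple I.out).length := length_le_encList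
    omega
  have hcard := hl.card_le
  have hvl := I.length_vars
  have hne : I.vars ≠ [] := by
    obtain ⟨x, hx⟩ := hc.1
    have hx : x < I.lhs.card := hx
    exact List.ne_nil_of_length_pos (by omega)
  -- sizes of the structures that the decomposition method handles
  have hA : StructureSizeLE N (I.restricted pick).lhs := structureSizeLE (by
    simp only [DecompositionMethod.callEll] at hV
    omega)
  -- The cost of a call includes the lengths of its input and output, so a bound on the cost also
  -- bounds the sizes of the views.
  have hVs : StructureSizeLE N (DM.ell (I.restricted pick).lhs).str := structureSizeLE (by
    simp only [DecompositionMethod.callEll, ViewStructure.encode, List.length_append] at hV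
    omega)
  have hBs : StructureSizeLE N (DM.r (I.restricted pick)) := structureSizeLE (by
    simp only [DecompositionMethod.callR] at hBV
    omega)
  have hviews : ViewsSizeLE N (DM.views pick I) := by
    constructor
    · rw [DecompositionMethod.views, initViewsT_val, List.length_map, List.length_zip]
      exact (min_le_left _ _).trans hVs.length_le
    · intro v hv
      obtain ⟨q, hq⟩ := List.mem_iff_getElem?.1 hv
      obtain ⟨a, c, ha, hc', rfl⟩ := initViewsT_getElem?.1 hq
      have ham := List.mem_of_getElem? ha
      have hcm := List.mem_of_getElem? hc'
      have hs := scope_mem_tuples ((DM.ell_view (I.restricted pick).lhs).single a ham)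
      exact ⟨hVs.tuple_le a ham _ (by rw [hs]; simp), hBs.tuples_le c hcm, hBs.tuple_le c hcm⟩
  -- steps before the search
  have h1 : I.restT.steps ≤ I.size + 1 + (I.size * (I.size * (1 + 1) + 1 + 1) + 1) := by
    simp only [ECSPInstance.restT, timed_bind_steps, rangeT]
    refine Nat.add_le_add (Nat.succ_le_succ hcard) (filterT_steps (fun x _ => ?_)
      (by simpa using hcard))
    exact anyT_steps (fun _ _ => le_rfl) hout
  have h2 : (domainRestrictedT I.toCSPInstance pick).steps ≤ domainRestrictedBound I.size :=
    domainRestrictedT_steps hl hr pick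
  have h3 : (initViewsT (DM.ell (I.restricted pick).lhs) (DM.r (I.restricted pick))).steps ≤
      N + N + 1 + (N * (1 + 1) + 1) := by
    have := hVs.length_le
    have := hBs.length_le
    simp only [initViewsT, timed_bind_steps, zipT]
    refine Nat.add_le_add (by omega) (mapT_steps (fun _ _ => le_rfl) ?_)
    rw [List.length_zip]
    omega
  have h4 : (domViewsT (DM.ell (I.restricted pick).lhs) (I.doms pick)).steps ≤
      N * (N + 1 + 1 + 1) + 1 := by
    have hd : DomainSymbols (I.restricted pick).lhs (I.doms pick) :=
      (domainRestrictedT_cases I.toCSPInstance pick).2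
    refine mapT_steps (fun d hdm => ?_) (hd.1.le.trans hA.card_le)
    obtain ⟨X, hX, rfl⟩ := List.mem_iff_getElem.1 hdm
    obtain ⟨r, hr', -⟩ := hd.2 X (hd.1 ▸ hX)
    rw [List.getD_eq_getElem _ _ hX] at hr'
    have := (List.getElem?_eq_some_iff.1 hr').1
    have := hA.length_le
    simp only [timed_bind_steps, nthT]
    omega
  have hgap := (DM.searchState pick hc).gap (m := I.out.length) (d := delayBound I.size N)
    (k := I.restT.steps + (appendT I.out I.restT.val).steps + (lengthT I.out).steps +
      (domainRestrictedT I.toCSPInstance pick).steps +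
      (DM.callEll (I.restricted pick).lhs).steps + (DM.callR (I.restricted pick)).steps +
      (initViewsT (DM.ell (I.restricted pick).lhs) (DM.r (I.restricted pick))).steps +
      (domViewsT (DM.ell (I.restricted pick).lhs) (I.doms pick)).steps)
    (DM.searchSpace pick hc)
    (callBound_spec (DM.searchSpace pick hc) hviews
      (fun X hX => by have := I.mem_vars.1 hX; omega) (by omega))
    (by
      have := Nat.mul_le_mul_right (2 * callBound N + 2) (show I.vars.length ≤ N by omega)
      simp only [delayBound]
      omega) hne
    (by
      have := Nat.mul_le_mul (show I.vars.length ≤ N by omega)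
        (show 2 * callBound N + 1 ≤ 2 * callBound N + 2 by omega)
      simp only [delayBound, appendT, lengthT]
      omega)
  simp only [computeCertifiedSolutions, gapLE_after, zero_add]
  exact hgap.1

theorem exists_gap_bound (DM : DecompositionMethod) :
    ∃ p : Polynomial ℕ, ∀ (I : ECSPInstance) (pick : ℕ → ℕ), IsConnected I.lhs.hypergraph →
      GapLE (p.eval I.size) 0 (computeCertifiedSolutions DM pick I).trace := by
  obtain ⟨q₁, hq₁, h₁⟩ := exists_call_bound DM.ell_poly
  obtain ⟨q₂, hq₂, h₂⟩ := exists_call_bound DM.r_poly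
  -- The method is called on the domain-restricted instance: `ell` receives one structure of size at
  -- most `structBound n`, `r` receives two.
  let N : ℕ → ℕ := fun n => n + (q₁ (structBound n) + q₂ (structBound n + structBound n))
  have hN : IsPoly N := IsPoly.id.add ((hq₁.comp .structBound).add
    (hq₂.comp (IsPoly.structBound.add .structBound)))
  have hcN : IsPoly fun n => callBound (N n) := IsPoly.callBound.comp hN
  have hd := IsPoly.domainRestrictedBound
  obtain ⟨p, hp⟩ : IsPoly fun n => delayBound n (N n) := by
    unfold delayBound
    repeat with_reducible first
      | exact hcN | exact hN | exact hd | exact IsPoly.const _ | exact IsPoly.id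
      | refine IsPoly.add ?_ ?_ | refine IsPoly.mul ?_ ?_
  refine ⟨p, fun I pick hc => ?_⟩
  rw [← hp]
  have hs : I.toCSPInstance.encode.length ≤ I.size := by
    simp only [ECSPInstance.size, ECSPInstance.encode, List.length_append]
    omega
  obtain ⟨he₁, he₂⟩ := encode_domainRestrictedT_le hs pick
  refine gap_computeCertifiedSolutions DM hc (by simp only [N]; omega) ?_ ?_
  · refine (h₁ _ _ he₁).trans ?_
    simp only [N]
    omega
  · refine (h₂ (structBound I.size + structBound I.size) _ ?_).trans ?_
    · simp only [CSPInstance.encode, List.length_append]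
      exact Nat.add_le_add he₁ he₂
    · simp only [N]
      omega

/-! ### Assembling the theorem -/

theorem CoveredBy.trans {H₁ H₂ H₃ : Hypergraph ℕ} (h : CoveredBy H₁ H₂) (h' : CoveredBy H₂ H₃) :
    CoveredBy H₁ H₃ := by
  intro e he
  obtain ⟨f, hf, hef⟩ := h e he
  obtain ⟨k, hk, hfk⟩ := h' f hf
  exact ⟨k, hk, hef.trans hfk⟩

end CertEnum

theorem mainTheorem5 (DM : CertEnum.DecompositionMethod) :
    ∃ p : Polynomial ℕ, ∀ (I : CertEnum.ECSPInstance) (pick : ℕ → ℕ),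
      CertEnum.IsConnected I.lhs.hypergraph →
        (CertEnum.computeCertifiedSolutions DM pick I).HasDelay (p.eval I.size) ∧
        (∀ h c, CertEnum.Event.solution h c ∈
            (CertEnum.computeCertifiedSolutions DM pick I).outputs →
          h ∈ I.solutions I.out ∧ I.IsCertificate h c) ∧
        (CertEnum.computeCertifiedSolutions DM pick I).projected.Nodup ∧
        (CertEnum.Event.failure ∈ (CertEnum.computeCertifiedSolutions DM pick I).outputs →
          ¬ CertEnum.HasTreeProjection I.lhs.hypergraph (DM.viewHypergraph pick I) ∧
          (CertEnum.CoveredBy (DM.ell I.lhs).str.hypergraph (DM.viewHypergraph pick I) →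
            ¬ CertEnum.HasTreeProjection I.lhs.hypergraph (DM.ell I.lhs).str.hypergraph)) ∧
        (CertEnum.Event.failure ∉ (CertEnum.computeCertifiedSolutions DM pick I).outputs →
          {h | h ∈ (CertEnum.computeCertifiedSolutions DM pick I).projected} =
            I.solutions I.out) := by
  obtain ⟨p, hp⟩ := CertEnum.exists_gap_bound DM
  refine ⟨p, fun I pick hc => ⟨(hp I pick hc).hasDelay, ?_⟩⟩
  rw [CertEnum.computeCertifiedSolutions_projected, CertEnum.computeCertifiedSolutions_outputs]
  have E := DM.searchSpace pick hc
  have hs := DM.searchState pick hc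
  have hsound : ∀ h c, CertEnum.Event.solution h c ∈ (DM.search pick I).outputs →
      h ∈ I.solutions I.out ∧ I.IsCertificate h c := by
    intro h c hm
    obtain ⟨g, hg, -, rfl, rfl⟩ := hs.soundRun E (m := I.out.length) h c hm
    exact CertEnum.IsCertificate.of_vars hg
  refine ⟨hsound, hs.projected_nodup E, fun hf => ?_, fun hf => ?_⟩
  · have hno : ¬ CertEnum.HasTreeProjection I.lhs.hypergraph (DM.viewHypergraph pick I) :=
      fun ht => DM.no_failure pick hc ht hf
    -- A tree projection with respect to the views of the original structure is also one with
    -- respect to any views that cover them.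
    exact ⟨hno, fun hcov ⟨Ha, h1, h2, h3⟩ => hno ⟨Ha, h1, h2, h3.trans hcov⟩⟩
  · ext h
    constructor
    · intro hm
      obtain ⟨c, hc'⟩ := CertEnum.Run.mem_projected.1 hm
      exact (hsound h c hc').1
    · rintro ⟨g, hg, rfl⟩
      have hne : I.vars ≠ [] := by
        obtain ⟨x, hx⟩ := hc.1
        exact List.ne_nil_of_mem (I.mem_vars.2 hx)
      have := hs.mem_projected E (m := I.out.length) hne hf hg (by simp)
      have h1 : (I.vars.map g).take I.out.length = I.out.map g := by
        rw [CertEnum.ECSPInstance.vars, List.map_append]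
        simp
      rw [h1] at this
      exact this
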